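/- Let $n\ge 1$ and let $C_n=\langle x\rangle$ be the cyclic group of order $n$. **The group $\mathbb{B}_{C_n}$.** Let $\Lambda_{C_n}$ be the commutative monoid, under concatenation $\oplus$, of unordered tuples $[\gamma_1,\dots,\gamma_q]$ ($q\ge 0$) of elements of $C_n$ with $\gamma_1\cdots\gamma_q=1$, where entries equal to $1$ may be inserted or deleted. Let $\mathbb{B}_{C_n}$ be the quotient of $\Lambda_{C_n}$ by the cancelling pairs $[\gamma,\gamma^{-1}]$, $\gamma\in C_n$; it is an abelian group with $-[\gamma_1,\dots,\gamma_q]=[\gamma_1^{-1},\dots,\gamma_q^{-1}]$ (the group of singular orbit data). **The representation quotient.** Let $R_{\mathbb{C}}C_n$ be the additive group of the complex representation ring (virtual characters) of $C_n$, let $\rho_j$ be the one-dimensional representation with $\rho_j(x)=e^{2\pi i j/n}$, let $D_{C_n}\subseteq R_{\mathbb{C}}C_n$ be the subgroup generated by all $\mathrm{Ind}_H^{C_n}\rho_0$, where $H\le C_n$ and $\rho_0$ is the trivial representation of $H$, and let $a\mapsto\bar a$ be the map which complex conjugation of representations induces on $R_{\mathbb{C}}C_n/D_{C_n}$. Put $\mathbb{A}_{C_n}=\{a\in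 R_{\mathbb{C}}C_n/D_{C_n} : a+\bar a=0\}$. **The map $\theta$.** For an action of $C_n$ on a closed oriented surface with singular orbit data $[x^{i_1},\dots,x^{i_q}]$ and quotient surface of genus $h$, the associated unitary representation $\varphi=\sum_{j=0}^{n-1}n_j\rho_j$ is given by $$n_0=h,\qquad n_j=h-1+q-\frac1n\sum_{s=1}^{q}k_s r_{sj}\quad(1\le j\le n-1),$$ where $k_s=\gcd(n,i_s)$, $i_s=l_sk_s$, and $r_{sj}$ is the unique integer with $1\le r_{sj}\le n/k_s$ and $r_{sj}\equiv j\,l_s \pmod{n/k_s}$. Modulo $D_{C_n}$ the class of $\sum_j n_j\rho_j$ does not depend on $h$, and it defines a homomorphism of abelian groups $$\theta:\mathbb{B}_{C_n}\to R_{\mathbb{C}}C_n/D_{C_n},\qquad [x^{i_1},\dots,x^{i_q}]\mapsto \Bigl[\sum_{j=0}^{n-1} n_j\rho_j\Bigr].$$ **Theorem.** The homomorphism $\theta$ is injective, its image is contained in $\mathbb{A}_{C_n}$, and the index of $\theta(\mathbb{B}_{C_n})$ in $\mathbb{A}_{C_n}$ is finite. Moreover $\mathbb{A}_{C_n}$ has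 rank $(n-1)/2$ if $n$ is odd and $n/2-1$ if $n$ is even. -/

import Mathlib

noncomputable section

namespace SingularOrbit

section Algebra

variable (G : Type) [CommGroup G]

/-- The commutative monoid of singular orbit data of an abelian group `G`: unordered tuples
`[γ₁, …, γ_q]` of elements of `G` with `γ₁ ⋯ γ_q = 1`, added by concatenation. As `G` is abelian,
conjugacy classes are single elements and the commutator subgroup is trivial. -/
def orbitData : AddSubmonoid (Multiset G) where
  carrier := {s | s.prod = 1}
  zero_mem' := Multiset.prod_zero
  add_mem' := by
    intro s t hs ht
    simp only [Set.mem_ofPred_eq] at hs ht ⊢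
    rw [Multiset.prod_add, hs, ht, one_mul]

/-- The relations imposed on singular orbit data: entries equal to `1` may be dropped, and
cancelling pairs `[γ, γ⁻¹]` are zero. -/
def ZeroRel (s t : orbitData G) : Prop :=
  t = 0 ∧ ((s : Multiset G) = {1} ∨ ∃ γ : G, (s : Multiset G) = {γ, γ⁻¹})

/-- The congruence on the monoid of singular orbit data generated by `ZeroRel`. -/
def orbitCon : AddCon (orbitData G) := addConGen (ZeroRel G)

/-- The group `𝔹_G` of singular orbit data of an abelian group `G`. -/
def 𝔹 : Type := (orbitCon G).Quotient

instance : AddCommMonoid (𝔹 G) := inferInstanceAs (AddCommMonoid (orbitCon G).Quotient)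

variable {G}

/-- The class in `𝔹_G` of a singular orbit datum. -/
def 𝔹.mk : orbitData G →+ 𝔹 G := (orbitCon G).mk'

theorem 𝔹.mk_surjective : Function.Surjective (𝔹.mk (G := G)) := AddCon.mk'_surjective

theorem 𝔹.mk_eq_of_zeroRel {s t : orbitData G} (h : ZeroRel G s t) : 𝔹.mk s = 𝔹.mk t :=
  (AddCon.eq _).2 (AddConGen.Rel.of _ _ h)

/-- Additive maps out of `𝔹_G`. -/
def 𝔹.lift {A : Type} [AddCommMonoid A] (f : orbitData G →+ A)
    (hf : ∀ s t, ZeroRel G s t → f s = f t) : 𝔹 G →+ A :=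
  (orbitCon G).lift f (AddCon.addConGen_le.2 fun s t h => hf s t h)

theorem 𝔹.lift_mk {A : Type} [AddCommMonoid A] (f : orbitData G →+ A)
    (hf : ∀ s t, ZeroRel G s t → f s = f t) (s : orbitData G) : 𝔹.lift f hf (𝔹.mk s) = f s := rfl

/-- `[γ₁, …, γ_q] ↦ [γ₁⁻¹, …, γ_q⁻¹]`. -/
def orbitData.inv : orbitData G →+ orbitData G :=
  ((Multiset.mapAddMonoidHom (fun γ : G => γ⁻¹)).comp (orbitData G).subtype).codRestrict
    (orbitData G) (by
      intro s
      have h : (s : Multiset G).prod = 1 := s.2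
      show (Multiset.map (fun γ : G => γ⁻¹) (s : Multiset G)).prod = 1
      rw [Multiset.prod_map_inv', h, inv_one])

theorem orbitData.coe_inv (s : orbitData G) :
    (orbitData.inv s : Multiset G) = (s : Multiset G).map (fun γ => γ⁻¹) := rfl

/-- The inverse in `𝔹_G`, induced by `[γ₁, …, γ_q] ↦ [γ₁⁻¹, …, γ_q⁻¹]`. -/
def 𝔹.neg : 𝔹 G →+ 𝔹 G :=
  𝔹.lift (𝔹.mk.comp orbitData.inv) (by
    rintro s t ⟨rfl, hs⟩
    rw [map_zero]
    refine (𝔹.mk_eq_of_zeroRel ⟨rfl, ?_⟩).trans (map_zero (𝔹.mk (G := G)))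
    rw [orbitData.coe_inv]
    rcases hs with hs | ⟨γ, hs⟩
    · left; rw [hs]; simp
    · right; exact ⟨γ⁻¹, by rw [hs]; simp⟩)

theorem 𝔹.mk_eq_zero (s : Multiset G) :
    ∀ h : s + s.map (fun γ => γ⁻¹) ∈ orbitData G, 𝔹.mk ⟨_, h⟩ = 0 := by
  induction s using Multiset.induction_on with
  | empty => intro h; exact map_zero (𝔹.mk (G := G))
  | cons γ s ih =>
    intro h
    have h1 : ({γ, γ⁻¹} : Multiset G) ∈ orbitData G := by
      show Multiset.prod _ = 1
      simp
    have h2 : s + s.map (fun γ => γ⁻¹) ∈ orbitData G := by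
      show Multiset.prod _ = 1
      rw [Multiset.prod_add, Multiset.prod_map_inv', mul_inv_cancel]
    have h3 : (⟨_, h⟩ : orbitData G) = ⟨_, h1⟩ + ⟨_, h2⟩ := by
      apply Subtype.ext
      show (γ ::ₘ s) + (γ ::ₘ s).map (fun γ => γ⁻¹)
        = ({γ, γ⁻¹} : Multiset G) + (s + s.map (fun γ => γ⁻¹))
      rw [Multiset.map_cons, Multiset.insert_eq_cons, ← Multiset.singleton_add γ,
        ← Multiset.singleton_add γ⁻¹, ← Multiset.singleton_add γ]
      abel
    rw [h3, map_add, ih h2, 𝔹.mk_eq_of_zeroRel ⟨rfl, Or.inr ⟨γ, rfl⟩⟩, map_zero, add_zero]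

instance : Neg (𝔹 G) := ⟨𝔹.neg⟩

instance : AddCommGroup (𝔹 G) :=
  { (inferInstance : AddCommMonoid (𝔹 G)), (inferInstance : Neg (𝔹 G)) with
    zsmul := zsmulRec
    neg_add_cancel := by
      intro a
      obtain ⟨s, rfl⟩ := 𝔹.mk_surjective a
      rw [add_comm]
      show 𝔹.mk s + 𝔹.mk (orbitData.inv s) = 0
      rw [← map_add]
      exact 𝔹.mk_eq_zero (s : Multiset G) (s + orbitData.inv s).2 }

theorem 𝔹.neg_mk (s : orbitData G) : -𝔹.mk s = 𝔹.mk (orbitData.inv s) := rfl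

end Algebra

section Rep

variable (G : Type) [Group G]

/-- The additive group of the complex representation ring of `G`: the group of virtual characters,
generated inside the functions on `G` by the characters of all finite-dimensional complex
representations. -/
def RC : AddSubgroup (G → ℂ) :=
  AddSubgroup.closure
    {χ | ∃ (d : ℕ) (ρ : Representation ℂ G (Fin d → ℂ)), χ = ρ.character}

variable {G}

/-- The character of any finite-dimensional complex representation lies in `RC G`. -/
theorem character_mem {V : Type*} [AddCommGroup V] [Module ℂ V] [FiniteDimensional ℂ V]
    (ρ : Representation ℂ G V) : ρ.character ∈ RC G := by
  let e : V ≃ₗ[ℂ] (Fin (Module.finrank ℂ V) → ℂ) := (Module.finBasis ℂ V).equivFun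
  let σ : Representation ℂ G (Fin (Module.finrank ℂ V) → ℂ) :=
    { toFun := fun g => e.conj (ρ g)
      map_one' := by simp [Module.End.one_eq_id]
      map_mul' := by
        intro g h
        rw [map_mul, Module.End.mul_eq_comp, LinearEquiv.conj_comp]; rfl }
  refine AddSubgroup.subset_closure ⟨_, σ, ?_⟩
  exact Representation.char_iso (Representation.Equiv.mk e (by
    intro g
    ext v
    simp [σ, LinearEquiv.conj_apply]))

/-- Pointwise complex conjugation of functions on `G`. -/
def conjFun : (G → ℂ) →+ (G → ℂ) := (starRingEnd ℂ).toAddMonoidHom.compLeft G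

theorem conjFun_apply {G : Type} (a : G → ℂ) (g : G) : conjFun a g = starRingEnd ℂ (a g) := rfl

theorem conjFun_mem {a : G → ℂ} (ha : a ∈ RC G) : conjFun a ∈ RC G := by
  induction ha using AddSubgroup.closure_induction with
  | mem χ h =>
    obtain ⟨d, ρ, rfl⟩ := h
    let σ : Representation ℂ G (Fin d → ℂ) :=
      { toFun := fun g => Matrix.toLin' ((LinearMap.toMatrix' (ρ g)).map (starRingEnd ℂ))
        map_one' := by
          rw [map_one, Module.End.one_eq_id, LinearMap.toMatrix'_id]
          simp
        map_mul' := by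
          intro g h
          rw [map_mul, LinearMap.toMatrix'_mul, Matrix.map_mul, Matrix.toLin'_mul]; rfl }
    refine AddSubgroup.subset_closure ⟨d, σ, ?_⟩
    ext g
    rw [conjFun_apply]
    show starRingEnd ℂ (LinearMap.trace ℂ _ (ρ g)) = LinearMap.trace ℂ _ (Matrix.toLin' _)
    rw [LinearMap.trace_eq_matrix_trace ℂ (Pi.basisFun ℂ (Fin d)), Matrix.trace_toLin'_eq,
      LinearMap.toMatrix_eq_toMatrix']
    simp [Matrix.trace]
  | zero => rw [map_zero]; exact (RC G).zero_mem
  | add a b _ _ ha hb => rw [map_add]; exact (RC G).add_mem ha hb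
  | neg a _ ha => rw [map_neg]; exact (RC G).neg_mem ha

/-- Complex conjugation of (virtual) representations. -/
def conjRC : RC G →+ RC G :=
  (conjFun.comp (RC G).subtype).codRestrict (RC G) fun a => conjFun_mem a.2

variable (G)

/-- The class of the representation induced from the trivial representation of `H`. -/
def indChar [Finite G] (H : Subgroup G) : RC G :=
  ⟨(Representation.ind H.subtype (Representation.trivial ℂ H ℂ)).character, character_mem _⟩

/-- The subgroup generated by the representations induced from the trivial representations of all
subgroups of `G`; for cyclic `G` this is `D_G`. -/
def D [Finite G] : AddSubgroup (RC G) := AddSubgroup.closure (Set.range (indChar G))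

end Rep

section IndTrivial
open scoped MonoidAlgebra
open Representation
variable {G : Type} [Group G] (H : Subgroup G)

/-- The comparison map from the induced trivial representation to `ℂ[G ⧸ H]`. -/
def indToPerm : IndV H.subtype (trivial ℂ H ℂ) →ₗ[ℂ] ℂ[G ⧸ H] :=
  Coinvariants.lift _
    ((MonoidAlgebra.mapDomainLinearMap ℂ ℂ fun g : G => ((g⁻¹ : G) : G ⧸ H)) ∘ₗ
      (TensorProduct.rid ℂ ℂ[G]).toLinearMap) (by
    intro s
    ext g
    simp)

/-- The inverse of `indToPerm`. -/
def permToInd : ℂ[G ⧸ H] →ₗ[ℂ] IndV H.subtype (trivial ℂ H ℂ) :=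
  Finsupp.lift _ ℂ (G ⧸ H) (fun x => IndV.mk H.subtype (trivial ℂ H ℂ) (x.out)⁻¹ 1) ∘ₗ
    (MonoidAlgebra.coeffLinearEquiv ℂ).toLinearMap

theorem indV_mk_eq (g : G) (s : H) :
    IndV.mk H.subtype (trivial ℂ H ℂ) ((s : G) * g) 1 = IndV.mk H.subtype (trivial ℂ H ℂ) g 1 := by
  have := Coinvariants.mk_self_apply
    (ρ := Representation.tprod ((leftRegular ℂ G).comp H.subtype) (trivial ℂ H ℂ)) s
    ((MonoidAlgebra.single g (1:ℂ)) ⊗ₜ[ℂ] (1:ℂ))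
  simpa using this

/-- The induced trivial representation is the permutation representation on `G ⧸ H`. -/
def indEquivPerm : (ind H.subtype (trivial ℂ H ℂ)).Equiv (ofMulAction ℂ G (G ⧸ H)) :=
  Representation.Equiv.mk
    (LinearEquiv.ofLinearMap (indToPerm H) (permToInd H)
      (by
        ext x
        simp [indToPerm, permToInd])
      (by
        apply IndV.hom_ext
        intro g
        ext
        simp only [LinearMap.comp_apply]
        have hg : ∃ t : H, ((((g⁻¹ : G) : G ⧸ H).out)⁻¹ : G) = (t : G) * g := by
          obtain ⟨t, ht⟩ := QuotientGroup.mk_out_eq_mul H g⁻¹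
          exact ⟨t⁻¹, by rw [ht]; simp⟩
        obtain ⟨t, ht⟩ := hg
        have := indV_mk_eq H g t
        rw [← ht] at this
        simpa [indToPerm, permToInd] using this))
    (by
      intro g
      apply IndV.hom_ext
      intro h
      ext
      simp [indToPerm])

theorem perm_char [Finite G] (g : G) : (ofMulAction ℂ G (G ⧸ H)).character g
   = Nat.card {x : G ⧸ H // g • x = x} := by
  classical
  have := Fintype.ofFinite (G ⧸ H)
  let b : Module.Basis (G ⧸ H) ℂ ℂ[G ⧸ H] := .ofRepr (MonoidAlgebra.coeffLinearEquiv ℂ)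
  have hb : ∀ x, b x = MonoidAlgebra.single x 1 := fun x => rfl
  rw [Representation.character, LinearMap.trace_eq_matrix_trace ℂ b, Matrix.trace]
  rw [Nat.card_eq_fintype_card, Fintype.card_subtype, Finset.card_filter, Nat.cast_sum]
  refine Finset.sum_congr rfl fun x _ => ?_
  rw [Matrix.diag_apply, LinearMap.toMatrix_apply, hb, ofMulAction_single]
  show (Finsupp.single (g • x) (1:ℂ)) x = _
  rw [Finsupp.single_apply]
  split_ifs <;> simp

theorem ind_char [Finite G] (g : G) : (ind H.subtype (trivial ℂ H ℂ)).character g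
   = Nat.card {x : G ⧸ H // g • x = x} := by
  rw [char_iso (indEquivPerm H), perm_char]

theorem ind_char_comm {G : Type} [CommGroup G] [Finite G] (H : Subgroup G) (g : G)
    [Decidable (g ∈ H)] :
    (ind H.subtype (trivial ℂ H ℂ)).character g = if g ∈ H then (H.index : ℂ) else 0 := by
  rw [ind_char]
  have key : ∀ x : G ⧸ H, g • x = x ↔ g ∈ H := by
    intro x
    induction x using QuotientGroup.induction_on with
    | H z =>
      show ((g * z : G) : G ⧸ H) = z ↔ _
      rw [QuotientGroup.eq, ← H.inv_mem_iff (x := g)]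
      congr! 1
      rw [mul_inv, mul_assoc, inv_mul_cancel, mul_one]
  split_ifs with hg
  · rw [Subgroup.index, Nat.card_congr (Equiv.subtypeUnivEquiv fun x => (key x).2 hg)]
  · have : IsEmpty {x : G ⧸ H // g • x = x} := ⟨fun x => hg ((key _).1 x.2)⟩
    simp

end IndTrivial

section Conj
variable (G : Type) [Group G] [Finite G]

theorem D_le_comap : D G ≤ (D G).comap conjRC := by
  rw [D, AddSubgroup.closure_le]
  rintro _ ⟨H, rfl⟩
  have : conjRC (indChar G H) = indChar G H := by
    apply Subtype.ext
    funext g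
    show starRingEnd ℂ ((Representation.ind _ _).character g) = (Representation.ind _ _).character g
    rw [ind_char, map_natCast]
  show conjRC (indChar G H) ∈ D G
  rw [this]
  exact AddSubgroup.subset_closure ⟨H, rfl⟩

/-- Complex conjugation `a ↦ ā` on the quotient of the representation ring by `D`. -/
def conjQ : (RC G ⧸ D G) →+ (RC G ⧸ D G) := QuotientAddGroup.map _ _ conjRC (D_le_comap G)

/-- The subgroup of all `a` with `a + ā = 0` in the quotient of the representation ring by `D`. -/
def 𝔸 : AddSubgroup (RC G ⧸ D G) where
  carrier := {a | a + conjQ G a = 0}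
  zero_mem' := by simp
  add_mem' := by
    intro a b ha hb
    simp only [Set.mem_ofPred_eq] at ha hb ⊢
    rw [map_add, add_add_add_comm, ha, hb, add_zero]
  neg_mem' := by
    intro a ha
    simp only [Set.mem_ofPred_eq] at ha ⊢
    rw [map_neg, ← neg_add, ha, neg_zero]

end Conj

section Cyclic

/-- The cyclic group of order `n`, written multiplicatively, with generator `x = ofAdd 1`. -/
abbrev C (n : ℕ) : Type := Multiplicative (ZMod n)

variable {n : ℕ} [NeZero n]

/-- The `i` with `0 ≤ i < n` and `γ = x ^ i`. -/
def exponent (γ : C n) : ℕ := (Multiplicative.toAdd γ).val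

/-- For `γ = x ^ i`: the number `k = gcd(n, i)`, so that `γ` has order `n / k`. -/
def gcdPart (γ : C n) : ℕ := Nat.gcd n (exponent γ)

/-- For `γ = x ^ i` and `k = gcd(n, i)`: the number `l` with `i = l * k`. -/
def coPart (γ : C n) : ℕ := exponent γ / gcdPart γ

/-- The unique integer `r` with `1 ≤ r ≤ n / k` and `r ≡ j * l` modulo `n / k`
(see `residue_spec`). -/
def residue (γ : C n) (j : ℕ) : ℕ :=
  if (j * coPart γ) % (n / gcdPart γ) = 0 then n / gcdPart γ else (j * coPart γ) % (n / gcdPart γ)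

/-- The multiplicity of `ρ_j` in the unitary representation of an action of `C n` on a closed surface
with singular orbit data `s = [γ₁, …, γ_q]` and quotient surface of genus `h`:
`n_0 = h` and `n_j = h - 1 + q - (∑ k_s * r_{s j}) / n` for `j ≠ 0`. The division is exact when
`γ₁ ⋯ γ_q = 1` (see `dvd_sum_gcdPart_mul_residue`). -/
def eigenMult (h : ℕ) (s : Multiset (C n)) (j : ℕ) : ℤ :=
  if j = 0 then h
  else h - 1 + Multiset.card s - ((s.map fun γ => gcdPart γ * residue γ j).sum : ℕ) / n

/-- The one-dimensional representation `ρ_j` of `C n`, with `ρ_j (x ^ a) = exp (2 π i j a / n)`. -/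
def rho (n : ℕ) [NeZero n] (j : ℕ) : Representation ℂ (C n) ℂ where
  toFun g := (ZMod.stdAddChar ((j : ZMod n) * Multiplicative.toAdd g)) • LinearMap.id
  map_one' := by simp [Module.End.one_eq_id]
  map_mul' g h := by
    rw [toAdd_mul, mul_add, AddChar.map_add_eq_mul, Module.End.mul_eq_comp]
    ext; simp

/-- The class of `ρ_j` in the representation ring. -/
def rhoChar (n : ℕ) [NeZero n] (j : ℕ) : RC (C n) := ⟨(rho n j).character, character_mem _⟩

/-- The unitary representation `∑ j, n_j ρ_j` attached to an action of `C n` with singular orbit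
data `s` and quotient surface of genus `h`. -/
def phi (h : ℕ) (s : Multiset (C n)) : RC (C n) :=
  ∑ j ∈ Finset.range n, eigenMult h s j • rhoChar n j

/-- The representative of `z` in `{1, …, n}`; an auxiliary form of `k * r`. -/
def wt (z : ZMod n) : ℕ := if z = 0 then n else z.val

theorem gcdPart_pos (γ : C n) : 0 < gcdPart γ := Nat.gcd_pos_of_pos_left _ (NeZero.pos n)

theorem residue_spec (γ : C n) (j : ℕ) :
    1 ≤ residue γ j ∧ residue γ j ≤ n / gcdPart γ ∧ residue γ j ≡ j * coPart γ [MOD n / gcdPart γ] := by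
  have hp : 0 < n / gcdPart γ := Nat.div_pos (Nat.gcd_le_left _ (NeZero.pos n)) (gcdPart_pos γ)
  unfold residue
  split_ifs with h
  · exact ⟨hp, le_rfl, by rw [Nat.ModEq, h, Nat.mod_self]⟩
  · exact ⟨Nat.pos_of_ne_zero h, (Nat.mod_lt _ hp).le, Nat.mod_modEq _ _⟩

theorem wt_eq (γ : C n) (j : ℕ) :
    gcdPart γ * residue γ j = wt ((j : ZMod n) * Multiplicative.toAdd γ) := by
  have hk := gcdPart_pos γ
  have hn : gcdPart γ * (n / gcdPart γ) = n := Nat.mul_div_cancel' (Nat.gcd_dvd_left _ _)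
  have hl : gcdPart γ * coPart γ = exponent γ := Nat.mul_div_cancel' (Nat.gcd_dvd_right _ _)
  have hz : (j : ZMod n) * Multiplicative.toAdd γ = ((j * exponent γ : ℕ) : ZMod n) := by
    rw [Nat.cast_mul, exponent, ZMod.natCast_zmod_val]
  have hm : gcdPart γ * ((j * coPart γ) % (n / gcdPart γ)) = (j * exponent γ) % n := by
    rw [← Nat.mul_mod_mul_left, hn, ← hl]; congr 1; ring
  have h0 : ((j * coPart γ) % (n / gcdPart γ) = 0) ↔ ((j * exponent γ : ℕ) : ZMod n) = 0 := by
    rw [ZMod.natCast_eq_zero_iff, Nat.dvd_iff_mod_eq_zero, ← hm]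
    simp [hk.ne']
  rw [hz, wt, residue]
  by_cases h : ((j * exponent γ : ℕ) : ZMod n) = 0
  · rw [if_pos h, if_pos (h0.2 h), hn]
  · rw [if_neg h, if_neg (fun hh => h (h0.1 hh)), hm, ZMod.val_natCast]

theorem wt_cast (z : ZMod n) : ((wt z : ℕ) : ZMod n) = z := by
  unfold wt; split_ifs with h
  · rw [h, ZMod.natCast_self]
  · exact ZMod.natCast_zmod_val z

/-- Auxiliary: `q - (∑ k_s * r_{s j}) / n`, as a function of `z = j` modulo `n`. -/
def baseMult (s : Multiset (C n)) (z : ZMod n) : ℤ :=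
  Multiset.card s - ((s.map fun γ => wt (z * Multiplicative.toAdd γ)).sum : ℕ) / n

theorem dvd_sum {s : Multiset (C n)} (hs : s.prod = 1) (z : ZMod n) :
    n ∣ (s.map fun γ => wt (z * Multiplicative.toAdd γ)).sum := by
  rw [← ZMod.natCast_eq_zero_iff]
  have : ∀ s : Multiset (C n),
      (((s.map fun γ => wt (z * Multiplicative.toAdd γ)).sum : ℕ) : ZMod n)
        = z * Multiplicative.toAdd s.prod := by
    intro s
    induction s using Multiset.induction_on with
    | empty => simp
    | cons γ s ih => rw [Multiset.map_cons, Multiset.sum_cons, Nat.cast_add, ih, wt_cast,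
        Multiset.prod_cons, toAdd_mul, mul_add]
  rw [this, hs, toAdd_one, mul_zero]

theorem dvd_sum_gcdPart_mul_residue (s : orbitData (C n)) (j : ℕ) :
    n ∣ ((s : Multiset (C n)).map fun γ => gcdPart γ * residue γ j).sum := by
  simp only [wt_eq]
  exact dvd_sum s.2 _

theorem baseMult_add {s t : Multiset (C n)} (hs : s.prod = 1) (z : ZMod n) :
    baseMult (s + t) z = baseMult s z + baseMult t z := by
  obtain ⟨m, hm⟩ := dvd_sum hs z
  have hn : (n : ℤ) ≠ 0 := by exact_mod_cast NeZero.ne n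
  unfold baseMult
  rw [Multiset.map_add, Multiset.sum_add, hm, Multiset.card_add]
  push_cast
  rw [Int.add_ediv_of_dvd_left (dvd_mul_right _ _)]
  ring

theorem eigenMult_eq (h : ℕ) (s : Multiset (C n)) (j : ℕ) :
    eigenMult h s j = (h - 1) + (if j = 0 then 1 else 0) + baseMult s j := by
  unfold eigenMult
  have hn : (n : ℤ) ≠ 0 := by exact_mod_cast NeZero.ne n
  split_ifs with hj
  · subst hj
    have : baseMult s ((0 : ℕ) : ZMod n) = 0 := by
      unfold baseMult
      simp [wt, Int.mul_ediv_cancel _ hn]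
    rw [this]; ring
  · unfold baseMult
    simp only [wt_eq]
    ring

theorem rhoChar_apply (j : ℕ) (g : C n) :
    (rhoChar n j : C n → ℂ) g = ZMod.stdAddChar ((j : ZMod n) * Multiplicative.toAdd g) := by
  show LinearMap.trace ℂ ℂ (ZMod.stdAddChar ((j : ZMod n) * Multiplicative.toAdd g) •
    (LinearMap.id : ℂ →ₗ[ℂ] ℂ)) = _
  simp

theorem sum_range_cast {M : Type*} [AddCommMonoid M] (f : ZMod n → M) :
    ∑ j ∈ Finset.range n, f (j : ZMod n) = ∑ z : ZMod n, f z := by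
  refine Finset.sum_nbij' (fun j => (j : ZMod n)) (fun z => z.val) ?_ ?_ ?_ ?_ ?_
  · simp
  · intro z _; exact Finset.mem_range.2 (ZMod.val_lt z)
  · intro j hj; exact ZMod.val_cast_of_lt (Finset.mem_range.1 hj)
  · intro z _; exact ZMod.natCast_zmod_val z
  · intro j _; rfl

theorem coe_sum_smul (c : ZMod n → ℤ) (g : C n) :
    ((∑ j ∈ Finset.range n, c j • rhoChar n j : RC (C n)) : C n → ℂ) g
      = ∑ z : ZMod n, (c z : ℂ) * ZMod.stdAddChar (z * Multiplicative.toAdd g) := by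
  rw [← sum_range_cast, AddSubgroup.val_finsetSum, Finset.sum_apply]
  refine Finset.sum_congr rfl fun j _ => ?_
  rw [AddSubgroup.coe_zsmul, Pi.smul_apply, rhoChar_apply, zsmul_eq_mul]

theorem sum_ann (a i : ZMod n) [Decidable (a ∈ AddSubgroup.zmultiples i)] :
    ∑ z : ZMod n, ((if z * i = 0 then 1 else 0 : ℤ) : ℂ) * ZMod.stdAddChar (z * a)
      = if a ∈ AddSubgroup.zmultiples i then ((AddSubgroup.zmultiples i).index : ℂ) else 0 := by
  classical
  have hcard : (Finset.univ.filter fun z : ZMod n => z * i = 0).card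
      = (AddSubgroup.zmultiples i).index := by
    let f : ZMod n →+ ZMod n := AddMonoidHom.mulRight i
    have h1 : Nat.card f.ker * Nat.card f.range = Nat.card (ZMod n) := by
      rw [← AddSubgroup.index_ker f, mul_comm, AddSubgroup.index_mul_card]
    have h2 : f.range = AddSubgroup.zmultiples i := by
      ext x
      rw [AddSubgroup.mem_zmultiples_iff]
      constructor
      · rintro ⟨z, rfl⟩
        exact ⟨z.val, by simp [f]⟩
      · rintro ⟨m, rfl⟩
        exact ⟨m, by simp [f]⟩
    have h3 : (Finset.univ.filter fun z : ZMod n => z * i = 0).card = Nat.card f.ker := by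
      rw [Nat.card_eq_fintype_card, ← Fintype.card_subtype]
      exact Fintype.card_congr (Equiv.refl _)
    rw [h3]
    rw [h2, ← AddSubgroup.index_mul_card (AddSubgroup.zmultiples i)] at h1
    exact Nat.eq_of_mul_eq_mul_right Nat.card_pos h1
  split_ifs with ha
  · obtain ⟨m, rfl⟩ := AddSubgroup.mem_zmultiples_iff.1 ha
    rw [← hcard, Finset.card_filter, Nat.cast_sum]
    refine Finset.sum_congr rfl fun z _ => ?_
    split_ifs with hz
    · rw [mul_smul_comm, hz, smul_zero, AddChar.map_zero_eq_one]; simp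
    · simp
  · obtain ⟨y, hy, hya⟩ : ∃ y : ZMod n, y * i = 0 ∧ y * a ≠ 0 := by
      by_contra! hcon
      apply ha
      have hk : 0 < Nat.gcd n i.val := Nat.gcd_pos_of_pos_left _ (NeZero.pos n)
      have hn : Nat.gcd n i.val * (n / Nat.gcd n i.val) = n :=
        Nat.mul_div_cancel' (Nat.gcd_dvd_left _ _)
      have hy : ((n / Nat.gcd n i.val : ℕ) : ZMod n) * i = 0 := by
        rw [← ZMod.natCast_zmod_val i, ← Nat.cast_mul, ZMod.natCast_eq_zero_iff]
        simp only [ZMod.natCast_zmod_val]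
        obtain ⟨l, hl⟩ := Nat.gcd_dvd_right n i.val
        refine ⟨l, ?_⟩
        calc n / Nat.gcd n i.val * i.val
            = n / Nat.gcd n i.val * (Nat.gcd n i.val * l) := by rw [← hl]
          _ = Nat.gcd n i.val * (n / Nat.gcd n i.val) * l := by ring
          _ = n * l := by rw [hn]
      have := hcon _ hy
      rw [← ZMod.natCast_zmod_val a, ← Nat.cast_mul, ZMod.natCast_eq_zero_iff] at this
      have hpos : 0 < n / Nat.gcd n i.val :=
        Nat.div_pos (Nat.gcd_le_left _ (NeZero.pos n)) hk
      have hdvd : Nat.gcd n i.val ∣ a.val := by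
        refine Nat.dvd_of_mul_dvd_mul_left hpos ?_
        rw [mul_comm, hn]
        exact this
      obtain ⟨t, ht⟩ := hdvd
      have hb : ((Nat.gcd n i.val : ℕ) : ZMod n) = i * (Nat.gcdB n i.val : ZMod n) := by
        have := congrArg (Int.cast : ℤ → ZMod n) (Nat.gcd_eq_gcd_ab n i.val)
        push_cast at this
        rw [this]
        simp
      rw [AddSubgroup.mem_zmultiples_iff]
      refine ⟨Nat.gcdB n i.val * t, ?_⟩
      rw [← ZMod.natCast_zmod_val a, ht, Nat.cast_mul, hb]
      simp
      ring
    have hne : ZMod.stdAddChar (y * a) ≠ 1 := fun h =>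
      hya (ZMod.injective_stdAddChar (h.trans (AddChar.map_zero_eq_one _).symm))
    have hshift : ZMod.stdAddChar (y * a) * ∑ z : ZMod n,
          ((if z * i = 0 then 1 else 0 : ℤ) : ℂ) * ZMod.stdAddChar (z * a)
        = ∑ z : ZMod n, ((if z * i = 0 then 1 else 0 : ℤ) : ℂ) * ZMod.stdAddChar (z * a) := by
      conv_rhs => rw [← Equiv.sum_comp (Equiv.addLeft y)]
      rw [Finset.mul_sum]
      refine Finset.sum_congr rfl fun z _ => ?_
      rw [Equiv.coe_addLeft, add_mul, hy, zero_add, add_mul, AddChar.map_add_eq_mul]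
      ring
    have : (ZMod.stdAddChar (y * a) - 1) * ∑ z : ZMod n,
          ((if z * i = 0 then 1 else 0 : ℤ) : ℂ) * ZMod.stdAddChar (z * a) = 0 := by
      rw [sub_mul, hshift, one_mul, sub_self]
    exact (mul_eq_zero.1 this).resolve_left (sub_ne_zero.2 hne)

theorem indChar_eq (γ : C n) :
    indChar (C n) (Subgroup.zpowers γ) = ∑ j ∈ Finset.range n,
      (if (j : ZMod n) * Multiplicative.toAdd γ = 0 then 1 else 0 : ℤ) • rhoChar n j := by
  classical
  apply Subtype.ext
  funext g
  rw [coe_sum_smul (fun z => if z * Multiplicative.toAdd γ = 0 then 1 else 0), sum_ann]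
  show (Representation.ind _ _).character g = _
  rw [ind_char_comm]
  have h1 : g ∈ Subgroup.zpowers γ ↔
      Multiplicative.toAdd g ∈ AddSubgroup.zmultiples (Multiplicative.toAdd γ) := Iff.rfl
  have h2 : (Subgroup.zpowers γ).index
      = (AddSubgroup.zmultiples (Multiplicative.toAdd γ)).index := rfl
  simp only [h1, h2]

theorem indChar_mem_D {G : Type} [Group G] [Finite G] (H : Subgroup G) : indChar G H ∈ D G :=
  AddSubgroup.subset_closure ⟨H, rfl⟩

theorem sum_rho_mem_D : (∑ j ∈ Finset.range n, rhoChar n j) ∈ D (C n) := by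
  have := indChar_mem_D (Subgroup.zpowers (1 : C n))
  rw [indChar_eq] at this
  simpa using this

theorem rho_zero_mem_D : rhoChar n 0 ∈ D (C n) := by
  have := indChar_mem_D (⊤ : Subgroup (C n))
  convert this using 1
  classical
  apply Subtype.ext
  funext g
  rw [rhoChar_apply]
  show _ = (Representation.ind _ _).character g
  rw [ind_char_comm]
  simp

theorem phi_eq (h : ℕ) (s : Multiset (C n)) :
    phi h s = ((h : ℤ) - 1) • (∑ j ∈ Finset.range n, rhoChar n j) + rhoChar n 0
      + ∑ j ∈ Finset.range n, baseMult s j • rhoChar n j := by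
  unfold phi
  simp only [eigenMult_eq, add_smul, Finset.sum_add_distrib, Finset.smul_sum]
  congr 2
  simp [ite_smul, NeZero.pos n, Finset.sum_ite_eq']

theorem mk_phi (h : ℕ) (s : Multiset (C n)) :
    (phi h s : RC (C n) ⧸ D (C n))
      = ((∑ j ∈ Finset.range n, baseMult s j • rhoChar n j : RC (C n)) : RC (C n) ⧸ D (C n)) := by
  rw [phi_eq, QuotientAddGroup.mk_add, (QuotientAddGroup.eq_zero_iff _).2, zero_add]
  exact (D (C n)).add_mem ((D (C n)).zsmul_mem sum_rho_mem_D _) rho_zero_mem_D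

theorem mk_phi_add (h h' h'' : ℕ) (s t : Multiset (C n)) (hs : s.prod = 1) :
    (phi h (s + t) : RC (C n) ⧸ D (C n)) = (phi h' s : RC (C n) ⧸ D (C n)) + phi h'' t := by
  simp only [mk_phi, baseMult_add hs, add_smul, Finset.sum_add_distrib, QuotientAddGroup.mk_add]

theorem mk_phi_one (h : ℕ) : (phi h ({1} : Multiset (C n)) : RC (C n) ⧸ D (C n)) = 0 := by
  have hn : (n : ℤ) ≠ 0 := by exact_mod_cast NeZero.ne n
  have : ∀ z : ZMod n, baseMult ({1} : Multiset (C n)) z = 0 := by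
    intro z; simp [baseMult, wt, Int.ediv_self hn]
  simp [mk_phi, this]

theorem mk_phi_pair (h : ℕ) (γ : C n) :
    (phi h ({γ, γ⁻¹} : Multiset (C n)) : RC (C n) ⧸ D (C n)) = 0 := by
  have hn : (n : ℤ) ≠ 0 := by exact_mod_cast NeZero.ne n
  have key : ∀ z : ZMod n, baseMult ({γ, γ⁻¹} : Multiset (C n)) z
      = 1 - (if z * Multiplicative.toAdd γ = 0 then 1 else 0 : ℤ) := by
    intro z
    simp only [baseMult, Multiset.insert_eq_cons, Multiset.map_cons, Multiset.map_singleton,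
      Multiset.sum_cons, Multiset.sum_singleton, Multiset.card_cons, Multiset.card_singleton,
      toAdd_inv, mul_neg]
    generalize z * Multiplicative.toAdd γ = u
    unfold wt
    by_cases hu : u = 0
    · subst hu
      have : ((n : ℤ) + n) / n = 2 := by
        rw [← two_mul]; exact Int.mul_ediv_cancel _ hn
      simp [this]
    · have : NeZero u := ⟨hu⟩
      have hlt := ZMod.val_lt u
      rw [if_neg hu, if_neg (neg_ne_zero.2 hu), if_neg hu, ZMod.val_neg_of_ne_zero,
        Nat.add_sub_cancel' hlt.le, Int.ediv_self hn]
      norm_num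
  simp only [mk_phi, key, sub_smul, one_smul, Finset.sum_sub_distrib]
  rw [QuotientAddGroup.eq_zero_iff]
  refine (D (C n)).sub_mem sum_rho_mem_D ?_
  rw [← indChar_eq]
  exact indChar_mem_D _

/-- The homomorphism `θ : 𝔹_{C_n} → R_ℂ C_n / D_{C_n}` induced by `phi`. The class of `phi h s` does
not depend on the genus `h` (see `theta_mk`); the definition uses `h = 1`. -/
def theta (n : ℕ) [NeZero n] : 𝔹 (C n) →+ RC (C n) ⧸ D (C n) :=
  𝔹.lift
    { toFun := fun s => (phi 1 (s : Multiset (C n)) : RC (C n) ⧸ D (C n))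
      map_zero' := by
        have := mk_phi_add 1 1 1 (0 : Multiset (C n)) 0 rfl
        rw [add_zero] at this
        exact left_eq_add.1 this
      map_add' := fun s t => mk_phi_add 1 1 1 _ _ s.2 }
    (by
      rintro s t ⟨rfl, hs⟩
      rw [map_zero]
      show (phi 1 (s : Multiset (C n)) : RC (C n) ⧸ D (C n)) = 0
      rcases hs with hs | ⟨γ, hs⟩
      · rw [hs]; exact mk_phi_one 1
      · rw [hs]; exact mk_phi_pair 1 γ)

/-- `θ` sends the class of `s` to the class of `phi h s`, for every `h`. -/
theorem theta_mk (h : ℕ) (s : orbitData (C n)) :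
    theta n (𝔹.mk s) = (phi h (s : Multiset (C n)) : RC (C n) ⧸ D (C n)) := by
  show (phi 1 (s : Multiset (C n)) : RC (C n) ⧸ D (C n)) = _
  rw [mk_phi, mk_phi]

end Cyclic
end SingularOrbit

end

/-!
The virtual characters of `C n` are the integral combinations `∑ c_z ρ_z` with `z ∈ ℤ/n`
(`ofCoeff_surjective`; the coefficients of a character are dimensions of spaces of invariants).
Conjugation replaces `c` by `z ↦ c (-z)`, and it fixes the generators of `D`, so
`c ↦ c z - c (-z)` is a homomorphism `oddMult` from the quotient by `D` to the lattice `OddFun n` of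
odd integral functions on `ℤ/n`, whose rank is `(n - 1) / 2` (`finrank_oddFun`). Restricted to `𝔸` it
has kernel killed by `2`, since there `a = ā` and `a + ā = 0`; and an odd `f` comes from the class of
`∑ f_z ρ_z`, up to the factor `2`. Hence `𝔸` has the same rank as `OddFun n` (`finrank_𝔸`).

On the other side, counting entries `γ` minus entries `γ⁻¹` defines `signedCount : 𝔹 → OddFun n`. It is
injective, because `C n` has at most one involution (`mk_eq_zero_of_map_inv_eq`), and its image
contains `2n` times the lattice, so `𝔹` has that same rank (`finrank_𝔹`).

The image of `θ` lies in `𝔸` because `θ (-b)` is the conjugate of `θ b`. In terms of odd functions `θ`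
is the matrix `saw (z i)` of the sawtooth function (`oddMult_theta`). Its nonsingularity on odd
functions (`eq_zero_of_sum_saw_eq_zero`) gives the injectivity of `θ`, and the equality of the ranks
then gives the finiteness of the index.

The nonsingularity rests on `L(1, χ) ≠ 0` for odd Dirichlet characters `χ`. The Fourier transform of
`saw` is a cotangent (`dft_saw`), and the values of the cotangent are those of the odd Hurwitz zeta
function at `1` (`hurwitzZetaOdd_one`). So if the matrix kills `f`, then for every `z` the Dirichlet
series `∑ g(mz)/m`, with `g` the Fourier transform of `f`, vanishes. At `s = 1` the Euler factors at the
primes dividing `n` are invertible, which allows the restriction of `m` to the units of `ℤ/n`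
(`LFunction_coprimePart_eq_zero`). The units act on the restricted series through characters, the
`χ`-component of `g` being multiplied by `L(1, χ)`; so every component of `g` vanishes
(`eq_zero_of_LFunction_one_eq_zero`).
-/

namespace SingularOrbit

/-! ### The odd Hurwitz zeta function at `1` -/

section CotangentSeries

open Filter Topology

/-- A bound for the terms of the odd Hurwitz zeta function that is uniform in the exponent
`s ∈ [1, 2]`. -/
theorem abs_rpow_neg_sub_rpow_neg_le {c x y s : ℝ} (hc : 0 < c) (hc1 : c ≤ 1) (hcx : c ≤ x)
    (hxy : x ≤ y) (hs : 1 ≤ s) (hs2 : s ≤ 2) :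
    |x ^ (-s) - y ^ (-s)| ≤ 2 * (y - x) / (c * (x * y)) := by
  have hx : 0 < x := hc.trans_le hcx
  have hy : 0 < y := hx.trans_le hxy
  have hmono : y ^ (-s) ≤ x ^ (-s) := Real.rpow_le_rpow_of_nonpos hx hxy (by linarith)
  rw [abs_of_nonneg (sub_nonneg.2 hmono)]
  have h1 : 1 - (x / y) ^ s ≤ 2 * (y - x) / y := by
    have hb := one_add_mul_self_le_rpow_one_add (s := x / y - 1) (by
      have : 0 ≤ x / y := by positivity
      linarith) hs
    rw [add_sub_cancel] at hb
    have h2 : s * (1 - x / y) ≤ 2 * (1 - x / y) :=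
      mul_le_mul_of_nonneg_right hs2 (sub_nonneg.2 ((div_le_one hy).2 hxy))
    have h3 : 2 * (y - x) / y = 2 * (1 - x / y) := by field_simp
    rw [h3]; linarith
  have h2 : x ^ (-s) ≤ 1 / (c * x) := by
    have e : x ^ (-s) = x ^ (-(s - 1)) * x⁻¹ := by
      rw [← Real.rpow_neg_one x, ← Real.rpow_add hx]; congr 1; ring
    have h3 : x ^ (-(s - 1)) ≤ c ^ (-(s - 1)) :=
      Real.rpow_le_rpow_of_nonpos hc hcx (by linarith)
    have h4 : c ^ (-(s - 1)) ≤ c ^ (-1 : ℝ) :=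
      Real.rpow_le_rpow_of_exponent_ge hc hc1 (by linarith)
    rw [Real.rpow_neg_one] at h4
    rw [e, one_div, mul_inv]
    exact mul_le_mul_of_nonneg_right (h3.trans h4) (by positivity)
  have h3 : x ^ (-s) - y ^ (-s) = x ^ (-s) * (1 - (x / y) ^ s) := by
    rw [mul_sub, mul_one, Real.div_rpow hx.le hy.le, Real.rpow_neg hx.le, Real.rpow_neg hy.le]
    have := (Real.rpow_pos_of_pos hx s).ne'
    field_simp
  have h4 : 0 ≤ 2 * (y - x) / y := div_nonneg (by linarith) hy.le
  calc x ^ (-s) - y ^ (-s) = x ^ (-s) * (1 - (x / y) ^ s) := h3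
    _ ≤ x ^ (-s) * (2 * (y - x) / y) := mul_le_mul_of_nonneg_left h1 (by positivity)
    _ ≤ 1 / (c * x) * (2 * (y - x) / y) := mul_le_mul_of_nonneg_right h2 h4
    _ = 2 * (y - x) / (c * (x * y)) := by field_simp

/-- The series of the odd Hurwitz zeta function is dominated, uniformly for `s ∈ [1, 2]`, by a
multiple of `∑ 1 / (k + 1) ^ 2`. -/
theorem norm_hurwitz_term_le {a : ℝ} (ha0 : 0 < a) (ha1 : a < 1) :
    ∃ C : ℝ, ∀ s : ℝ, 1 ≤ s → s ≤ 2 → ∀ k : ℕ,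
      |((k + a) ^ (-s) - (k + 1 - a) ^ (-s)) / 2| ≤ C * (1 / ((k + 1 : ℕ) : ℝ) ^ 2) := by
  set c := min a (1 - a) with hcdef
  have hc : 0 < c := lt_min ha0 (by linarith)
  have hca : c ≤ a := min_le_left _ _
  have hca' : c ≤ 1 - a := min_le_right _ _
  have hc1 : c ≤ 1 := hca.trans ha1.le
  refine ⟨1 / (c * (c * c)), fun s hs hs2 k => ?_⟩
  have hk : (0 : ℝ) ≤ k := k.cast_nonneg
  have key : ∀ x y : ℝ, k + c ≤ x → x ≤ y → y - x ≤ 1 →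
      |x ^ (-s) - y ^ (-s)| ≤ 2 * (1 / (c * (c * c)) * (1 / ((k + 1 : ℕ) : ℝ) ^ 2)) := by
    intro x y hx hxy hyx
    -- `c ≤ 1`, so `c (k + 1) ≤ k + c`
    have hlow : c * (k + 1) ≤ x := by nlinarith
    have hk1 : (0 : ℝ) < c * (k + 1) := by positivity
    refine (abs_rpow_neg_sub_rpow_neg_le hc hc1 (by linarith) hxy hs hs2).trans ?_
    have hp : c * ((c * (k + 1)) * (c * (k + 1))) ≤ c * (x * y) :=
      mul_le_mul_of_nonneg_left (mul_le_mul hlow (hlow.trans hxy) hk1.le (hk1.le.trans hlow)) hc.le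
    calc 2 * (y - x) / (c * (x * y)) ≤ 2 / (c * ((c * (k + 1)) * (c * (k + 1)))) :=
          div_le_div₀ (by norm_num) (by linarith) (by positivity) hp
      _ = _ := by push_cast; field_simp
  rw [abs_div, abs_two, div_le_iff₀ two_pos, mul_comm _ (2 : ℝ)]
  rcases le_total (k + a : ℝ) (k + 1 - a) with h | h
  · exact key _ _ (by linarith) h (by linarith)
  · rw [abs_sub_comm]
    exact key _ _ (by linarith) h (by linarith)

/-- The Mittag-Leffler expansion of the cotangent, as a series over the pairs of terms that occur
in the odd Hurwitz zeta function. -/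
theorem tsum_one_div_sub_one_div_eq_cot {a : ℝ} (ha0 : 0 < a) (ha1 : a < 1)
    (hsum : Summable fun k : ℕ => ((1 / (k + a : ℂ) - 1 / (k + 1 - a : ℂ)) / 2)) :
    ∑' k : ℕ, ((1 / (k + a : ℂ) - 1 / (k + 1 - a : ℂ)) / 2)
      = Real.pi / 2 * Complex.cot (Real.pi * a) := by
  have hz : (a : ℂ) ∈ Complex.integerComplement := by
    rw [Complex.mem_integerComplement_iff]
    rintro ⟨m, hm⟩
    have hm' : (m : ℝ) = a := by exact_mod_cast hm
    rw [← hm'] at ha0 ha1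
    have h0 : 0 < m := by exact_mod_cast ha0
    have h1 : m < 1 := by exact_mod_cast ha1
    omega
  have hcot := cot_series_rep' hz
  have hS : Summable fun k : ℕ => (1 / ((a : ℂ) - (k + 1)) + 1 / ((a : ℂ) + (k + 1))) :=
    summable_cotTerm hz
  have h1 := hS.hasSum.tendsto_sum_nat
  rw [← hcot] at h1
  have h2 := hsum.hasSum.tendsto_sum_nat
  -- both series have the same terms up to a shift of `1 / (k + a)` by one index
  have hpart : ∀ N : ℕ, ∑ k ∈ Finset.range N, ((1 / (k + a : ℂ) - 1 / (k + 1 - a : ℂ)) / 2)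
      = (∑ k ∈ Finset.range N, (1 / ((a : ℂ) - (k + 1)) + 1 / ((a : ℂ) + (k + 1)))
          + 1 / a - 1 / (N + a : ℂ)) / 2 := by
    intro N
    induction N with
    | zero => simp
    | succ N ih =>
      rw [Finset.sum_range_succ, ih, Finset.sum_range_succ]
      have e1 : 1 / ((a : ℂ) - (N + 1)) = -(1 / (N + 1 - a : ℂ)) := by
        rw [← one_div_neg_eq_neg_one_div]; congr 1; ring
      have e2 : (a : ℂ) + (N + 1) = ((N + 1 : ℕ) : ℂ) + a := by push_cast; ring
      rw [e1, e2]
      ring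
  have h3 : Tendsto (fun N : ℕ => 1 / ((N : ℂ) + a)) atTop (𝓝 0) := by
    have hr : Tendsto (fun N : ℕ => 1 / ((N : ℝ) + a)) atTop (𝓝 0) := by
      simp only [one_div]
      exact tendsto_inv_atTop_zero.comp
        (tendsto_atTop_add_const_right _ _ tendsto_natCast_atTop_atTop)
    have := (Complex.continuous_ofReal.tendsto 0).comp hr
    simpa [Function.comp_def] using this
  refine tendsto_nhds_unique h2 ?_
  simp only [hpart]
  have := ((h1.add_const (1 / (a : ℂ))).sub h3).div_const 2
  convert this using 2
  ring

/-- The value at `1` of the odd Hurwitz zeta function, outside the range where its Dirichlet series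
converges absolutely. -/
theorem hurwitzZetaOdd_one {a : ℝ} (ha0 : 0 < a) (ha1 : a < 1) :
    HurwitzZeta.hurwitzZetaOdd (a : UnitAddCircle) 1
      = Real.pi / 2 * Complex.cot (Real.pi * a) := by
  obtain ⟨C, hC⟩ := norm_hurwitz_term_le ha0 ha1
  have hterm : ∀ (s : ℝ) (k : ℕ),
      (1 / (k + a : ℂ) ^ (s : ℂ) - 1 / (k + 1 - a : ℂ) ^ (s : ℂ)) / 2
        = ((((k + a) ^ (-s) - (k + 1 - a) ^ (-s)) / 2 : ℝ) : ℂ) := by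
    intro s k
    have hk : (0 : ℝ) ≤ k := k.cast_nonneg
    have h1 : (0 : ℝ) ≤ k + a := by linarith
    have h2 : (0 : ℝ) ≤ k + 1 - a := by linarith
    rw [Real.rpow_neg h1, Real.rpow_neg h2]
    push_cast [Complex.ofReal_cpow h1, Complex.ofReal_cpow h2]
    simp only [one_div]
  have hbound : Summable fun k : ℕ => C * (1 / ((k + 1 : ℕ) : ℝ) ^ 2) :=
    ((summable_nat_add_iff (f := fun k : ℕ => 1 / (k : ℝ) ^ 2) 1).2
      (Real.summable_one_div_nat_pow.2 one_lt_two)).mul_left C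
  have hnorm : ∀ s : ℝ, 1 ≤ s → s ≤ 2 → ∀ k : ℕ,
      ‖(1 / (k + a : ℂ) ^ (s : ℂ) - 1 / (k + 1 - a : ℂ) ^ (s : ℂ)) / 2‖
        ≤ C * (1 / ((k + 1 : ℕ) : ℝ) ^ 2) := by
    intro s hs hs2 k
    rw [hterm, Complex.norm_real, Real.norm_eq_abs]
    exact hC s hs hs2 k
  have hsum1 : Summable fun k : ℕ => ((1 / (k + a : ℂ) - 1 / (k + 1 - a : ℂ)) / 2) := by
    refine Summable.of_norm_bounded hbound fun k => ?_
    simpa using hnorm 1 le_rfl one_le_two k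
  rw [← tsum_one_div_sub_one_div_eq_cot ha0 ha1 hsum1]
  have hlim : Tendsto (fun s : ℝ => ∑' k : ℕ,
      (1 / (k + a : ℂ) ^ (s : ℂ) - 1 / (k + 1 - a : ℂ) ^ (s : ℂ)) / 2) (𝓝[>] 1)
      (𝓝 (∑' k : ℕ, ((1 / (k + a : ℂ) - 1 / (k + 1 - a : ℂ)) / 2))) := by
    refine tendsto_tsum_of_dominated_convergence hbound (fun k => ?_) ?_
    · have hne : ∀ b : ℝ, 0 < b →
          Tendsto (fun s : ℝ => 1 / ((b : ℂ)) ^ (s : ℂ)) (𝓝[>] 1) (𝓝 (1 / (b : ℂ))) := by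
        intro b hb
        have hb' : (b : ℂ) ≠ 0 := by exact_mod_cast hb.ne'
        have hcont : Continuous fun s : ℝ => 1 / ((b : ℂ)) ^ (s : ℂ) := by
          refine continuous_const.div ?_ fun s => by simp [Complex.cpow_eq_zero_iff, hb']
          exact (Complex.continuous_ofReal).const_cpow (Or.inl hb')
        have := (hcont.tendsto 1).mono_left (nhdsWithin_le_nhds (s := Set.Ioi 1))
        simpa using this
      have hk : (0 : ℝ) ≤ k := k.cast_nonneg
      have e1 := hne (k + a) (by linarith)
      have e2 := hne (k + 1 - a) (by linarith)
      push_cast at e1 e2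
      exact (e1.sub e2).div_const 2
    · have : ∀ᶠ s : ℝ in 𝓝[>] 1, s ∈ Set.Ioo (1 : ℝ) 2 := Ioo_mem_nhdsGT one_lt_two
      filter_upwards [this] with s hs k
      exact hnorm s hs.1.le hs.2.le k
  have hlim2 : Tendsto (fun s : ℝ => HurwitzZeta.hurwitzZetaOdd (a : UnitAddCircle) (s : ℂ))
      (𝓝[>] 1) (𝓝 (HurwitzZeta.hurwitzZetaOdd (a : UnitAddCircle) 1)) := by
    have hcont := (HurwitzZeta.differentiable_hurwitzZetaOdd (a : UnitAddCircle)).continuous.comp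
      Complex.continuous_ofReal
    have := (hcont.tendsto 1).mono_left (nhdsWithin_le_nhds (s := Set.Ioi 1))
    simpa [Function.comp_def] using this
  refine tendsto_nhds_unique hlim2 (hlim.congr' ?_)
  filter_upwards [self_mem_nhdsWithin] with s hs
  exact (HurwitzZeta.hasSum_nat_hurwitzZetaOdd_of_mem_Icc ⟨ha0.le, ha1.le⟩ (by simpa using hs)).tsum_eq

end CotangentSeries

/-! ### The sawtooth function and its Fourier transform -/

section Sawtooth

open ZMod

variable {n : ℕ} [NeZero n]

/-- The sawtooth function `u ↦ 1/2 - {u/n}` on `ℤ/n`, made odd by giving it the value `0` at `0`. -/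
noncomputable def saw (u : ZMod n) : ℂ := if u = 0 then 0 else 1 / 2 - (u.val : ℂ) / n

theorem saw_odd : (saw : ZMod n → ℂ).Odd := by
  intro u
  unfold saw
  by_cases hu : u = 0
  · simp [hu]
  · have : NeZero u := ⟨hu⟩
    have hn : (n : ℂ) ≠ 0 := by exact_mod_cast NeZero.ne n
    rw [if_neg hu, if_neg (neg_ne_zero.2 hu), ZMod.val_neg_of_ne_zero,
      Nat.cast_sub (ZMod.val_lt u).le]
    field_simp
    ring

theorem stdAddChar_mul_eq_pow (u j : ZMod n) :
    stdAddChar (-(u * j)) = stdAddChar (-j) ^ u.val := by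
  rw [← AddChar.map_nsmul_eq_pow, nsmul_eq_mul, ZMod.natCast_zmod_val, mul_neg]

/-- The finite Fourier transform of the sawtooth function is the cotangent. -/
theorem dft_saw (j : ZMod n) :
    𝓕 (saw : ZMod n → ℂ) j = -(Complex.I / 2) * Complex.cot (Real.pi * ((j.val / n : ℝ) : ℂ)) := by
  have hn : (n : ℂ) ≠ 0 := by exact_mod_cast NeZero.ne n
  by_cases hj : j = 0
  · subst hj
    simp [dft_apply_zero, saw_odd.sum_eq_zero, Complex.cot]
  set w : ℂ := stdAddChar (-j) with hw
  have hw1 : w ≠ 1 := fun h => neg_ne_zero.2 hj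
    (injective_stdAddChar (h.trans (AddChar.map_zero_eq_one _).symm))
  have hw1' : w - 1 ≠ 0 := sub_ne_zero.2 hw1
  have hwn : w ^ n = 1 := by
    rw [hw, ← AddChar.map_nsmul_eq_pow, nsmul_eq_mul, ZMod.natCast_self, zero_mul,
      AddChar.map_zero_eq_one]
  have hgeom : ∑ k ∈ Finset.range n, w ^ k = 0 := by
    rw [geom_sum_eq hw1, hwn, sub_self, zero_div]
  -- summation by parts for `∑ k w ^ k`
  have hlin : (w - 1) * ∑ k ∈ Finset.range n, (k : ℂ) * w ^ k = n := by
    have h : ∀ N : ℕ, (w - 1) * ∑ k ∈ Finset.range N, (k : ℂ) * w ^ k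
        = N * w ^ N - w * ∑ k ∈ Finset.range N, w ^ k := by
      intro N
      induction N with
      | zero => simp
      | succ N ih =>
        rw [Finset.sum_range_succ, mul_add, ih, Finset.sum_range_succ]
        push_cast; ring
    rw [h, hgeom, hwn]; ring
  have hsum : 𝓕 (saw : ZMod n → ℂ) j
      = ∑ k ∈ Finset.range n, w ^ k * (1 / 2 - (k : ℂ) / n) - 1 / 2 := by
    have h1 : ∀ u : ZMod n, stdAddChar (-(u * j)) • saw u
        = w ^ u.val * (1 / 2 - (u.val : ℂ) / n) - if u = 0 then 1 / 2 else 0 := by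
      intro u
      rw [stdAddChar_mul_eq_pow, smul_eq_mul, saw]
      split_ifs with hu
      · simp [hu]
      · simp [hw]
    rw [dft_apply, Finset.sum_congr rfl fun u _ => h1 u, Finset.sum_sub_distrib,
      Finset.sum_ite_eq' Finset.univ (0 : ZMod n), if_pos (Finset.mem_univ _),
      ← sum_range_cast]
    congr 1
    refine Finset.sum_congr rfl fun k hk => ?_
    rw [ZMod.val_cast_of_lt (Finset.mem_range.1 hk)]
  have hval : 𝓕 (saw : ZMod n → ℂ) j = -(w + 1) / (2 * (w - 1)) := by
    have h2 : ∑ k ∈ Finset.range n, w ^ k * (1 / 2 - (k : ℂ) / n)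
        = (1 / 2) * ∑ k ∈ Finset.range n, w ^ k
          - (1 / n) * ∑ k ∈ Finset.range n, (k : ℂ) * w ^ k := by
      rw [Finset.mul_sum, Finset.mul_sum, ← Finset.sum_sub_distrib]
      exact Finset.sum_congr rfl fun k _ => by ring
    have h3 : ∑ k ∈ Finset.range n, (k : ℂ) * w ^ k = n / (w - 1) := by
      rw [eq_div_iff hw1', mul_comm, hlin]
    rw [hsum, h2, hgeom, h3]
    field_simp
    ring
  have hexp : Complex.exp (2 * Real.pi * Complex.I * ((j.val / n : ℝ) : ℂ)) = w⁻¹ := by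
    rw [hw, AddChar.map_neg_eq_inv, inv_inv, stdAddChar_apply, ← ZMod.natCast_zmod_val j,
      toCircle_natCast]
    simp only [ZMod.natCast_zmod_val]
    congr 1
    push_cast; ring
  have hw0 : w ≠ 0 := by rintro h; rw [h, zero_pow (NeZero.ne n)] at hwn; exact zero_ne_one hwn
  rw [hval, Complex.cot_pi_eq_exp_ratio, hexp]
  have h4 : (1 : ℂ) - w⁻¹ ≠ 0 := by
    rw [sub_ne_zero]; intro h; exact hw1 (by rw [← inv_inv w, ← h, inv_one])
  have hI := Complex.I_ne_zero
  have h5 : 1 - w⁻¹ = (w - 1) / w := by field_simp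
  rw [h5]
  field_simp
  ring

/-- The value at `1` of the `L`-function of an odd function `g` on `ℤ/n` is the pairing of `g` with
the Fourier transform of the sawtooth function. -/
theorem LFunction_one_of_odd {g : ZMod n → ℂ} (hg : g.Odd) :
    LFunction g 1 = Real.pi * Complex.I / n * ∑ j, g j * 𝓕 (saw : ZMod n → ℂ) j := by
  have hn0 : (0 : ℝ) < n := by exact_mod_cast NeZero.pos n
  rw [LFunction_def_odd hg, Complex.cpow_neg_one, Finset.mul_sum, Finset.mul_sum]
  refine Finset.sum_congr rfl fun j _ => ?_
  by_cases hj : j = 0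
  · subst hj
    have : g 0 = 0 := by
      have := hg 0
      rw [neg_zero] at this
      exact self_eq_neg.1 this
    simp [this]
  · have hv : 0 < j.val := Nat.pos_of_ne_zero fun h => hj ((ZMod.val_eq_zero j).1 h)
    rw [toAddCircle_apply, hurwitzZetaOdd_one (div_pos (by exact_mod_cast hv) hn0)
      ((div_lt_one hn0).2 (by exact_mod_cast ZMod.val_lt j)), dft_saw]
    linear_combination ((n : ℂ)⁻¹ * g j * (Real.pi / 2)
      * Complex.cot (Real.pi * ((j.val / n : ℝ) : ℂ))) * Complex.I_sq

end Sawtooth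

/-! ### Removal of Euler factors at `s = 1` -/

section EulerFactors

open ZMod Filter Topology

variable {n : ℕ}

/-- Restriction of a function on `ℤ/n` to the classes coprime to `d`; this is meaningful when `d`
divides `n`. -/
noncomputable def coprimePart (d : ℕ) (g : ZMod n → ℂ) (m : ZMod n) : ℂ :=
  if m.val.Coprime d then g m else 0

theorem coprimePart_natCast {d : ℕ} (hd : d ∣ n) (g : ZMod n → ℂ) (k : ℕ) :
    coprimePart d g (k : ZMod n) = if k.Coprime d then g k else 0 := by
  have h : (k % n).Coprime d ↔ k.Coprime d := by
    rw [Nat.Coprime, Nat.Coprime, ((Nat.mod_modEq k n).of_dvd hd).gcd_eq]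
  rw [coprimePart, ZMod.val_natCast]
  simp only [h]

variable [NeZero n]

theorem coprimePart_odd {d : ℕ} (hd : d ∣ n) {g : ZMod n → ℂ} (hg : g.Odd) :
    (coprimePart d g).Odd := by
  intro m
  have h : (-m).val.Coprime d ↔ m.val.Coprime d := by
    by_cases hm : m = 0
    · simp [hm]
    · have : NeZero m := ⟨hm⟩
      rw [ZMod.val_neg_of_ne_zero]
      obtain ⟨c, hc⟩ := hd
      have hle := (ZMod.val_lt m).le
      rw [Nat.Coprime, Nat.Coprime, ← Int.gcd_natCast_natCast, ← Int.gcd_natCast_natCast,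
        Nat.cast_sub hle]
      have : ((n : ℤ) - m.val) = -(m.val : ℤ) + d * c := by
        rw [show (n : ℤ) = d * c by exact_mod_cast hc]; ring
      rw [this, Int.gcd_add_mul_left_left, Int.neg_gcd]
  unfold coprimePart
  rw [hg m]
  simp only [h]
  split_ifs <;> simp

/-- Removing the Euler factor of a prime `p` from a Dirichlet series whose coefficients are periodic
modulo a multiple of `p`. -/
theorem LFunction_coprimePart_mul {p d : ℕ} (hp : p.Prime) (hpn : p ∣ n) (hd : d ∣ n)
    (hpd : p.Coprime d) (g : ZMod n → ℂ) {s : ℂ} (hs : 1 < s.re) :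
    LFunction (coprimePart (p * d) g) s = LFunction (coprimePart d g) s
      - (p : ℂ) ^ (-s) * LFunction (coprimePart d fun m => g ((p : ZMod n) * m)) s := by
  have hdn : p * d ∣ n := hpd.mul_dvd_of_dvd_of_dvd hpn hd
  rw [LFunction_eq_LSeries _ hs, LFunction_eq_LSeries _ hs, LFunction_eq_LSeries _ hs]
  set T : ℕ → ℂ := LSeries.term (fun k => coprimePart d g (k : ZMod n)) s with hT
  set U : ℕ → ℂ := LSeries.term (fun k => coprimePart (p * d) g (k : ZMod n)) s with hU
  have hsT : Summable T := LSeriesSummable_of_one_lt_re _ hs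
  have hsU : Summable U := LSeriesSummable_of_one_lt_re _ hs
  have hdiff : ∀ k, T k - U k = if p ∣ k then T k else 0 := by
    intro k
    rcases Nat.eq_zero_or_pos k with rfl | hk
    · simp [hT, hU]
    · rw [hT, hU, LSeries.term_of_ne_zero hk.ne', LSeries.term_of_ne_zero hk.ne',
        coprimePart_natCast hd, coprimePart_natCast hdn]
      by_cases hpk : p ∣ k
      · have e : ¬ k.Coprime (p * d) := fun h =>
          hp.coprime_iff_not_dvd.1 (Nat.coprime_mul_iff_right.1 h).1.symm hpk
        rw [if_neg e, zero_div, sub_zero, if_pos hpk]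
      · have e : k.Coprime (p * d) ↔ k.Coprime d :=
          Nat.coprime_mul_iff_right.trans
            (and_iff_right (hp.coprime_iff_not_dvd.2 hpk).symm)
        simp only [e, sub_self, if_neg hpk]
  -- the terms lost are those at multiples of `p`
  have hmul : ∑' k, (T k - U k)
      = (p : ℂ) ^ (-s) * LSeries (fun k => coprimePart d (fun m => g ((p : ZMod n) * m)) (k : ZMod n)) s := by
    have hinj : Function.Injective fun k : ℕ => p * k :=
      fun a b h => Nat.eq_of_mul_eq_mul_left hp.pos h
    rw [← hinj.tsum_eq, LSeries, ← tsum_mul_left]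
    · refine tsum_congr fun k => ?_
      simp only [hdiff, dvd_mul_right, if_true]
      rcases Nat.eq_zero_or_pos k with rfl | hk
      · simp [hT]
      · rw [hT, LSeries.term_of_ne_zero (Nat.mul_pos hp.pos hk).ne',
          LSeries.term_of_ne_zero hk.ne', coprimePart_natCast hd, coprimePart_natCast hd,
          Nat.cast_mul, Nat.cast_mul, Complex.natCast_mul_natCast_cpow, Complex.cpow_neg]
        have e : (p * k).Coprime d ↔ k.Coprime d :=
          Nat.coprime_mul_iff_left.trans (and_iff_right hpd)
        simp only [e]
        split_ifs
        · field_simp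
        · simp
    · intro k hk
      rw [Function.mem_support, hdiff] at hk
      obtain ⟨m, rfl⟩ : p ∣ k := by
        by_contra h
        exact hk (if_neg h)
      exact ⟨m, rfl⟩
  rw [← hmul, hsT.tsum_sub hsU]
  show _ = ∑' k, T k - _
  rw [sub_sub_cancel]
  rfl

theorem tendsto_LFunction_one {g : ZMod n → ℂ} (hg : g.Odd) :
    Tendsto (fun s : ℝ => LFunction g (s : ℂ)) (𝓝[>] 1) (𝓝 (LFunction g 1)) := by
  have hcont := (differentiable_LFunction_of_sum_zero hg.sum_eq_zero).continuous.comp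
    Complex.continuous_ofReal
  have := (hcont.tendsto 1).mono_left (nhdsWithin_le_nhds (s := Set.Ioi 1))
  simpa [Function.comp_def] using this

/-- At `s = 1` the Euler factor of a prime `p` dividing `n` is invertible, so it can be removed:
if the `L`-functions of all `m ↦ g (m z)` vanish at `1`, they still do after restriction to `m`
coprime to `n`. -/
theorem LFunction_coprimePart_eq_zero {g : ZMod n → ℂ} (hg : g.Odd)
    (h : ∀ z, LFunction (fun m => g (m * z)) 1 = 0) {d : ℕ} (hd : d ∣ n) :
    ∀ z, LFunction (coprimePart d fun m => g (m * z)) 1 = 0 := by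
  have hodd : ∀ z, (fun m => g (m * z)).Odd := fun z m => by
    show g (-m * z) = -g (m * z)
    rw [neg_mul, hg]
  induction d using induction_on_primes with
  | zero => exact absurd (zero_dvd_iff.1 hd) (NeZero.ne n)
  | one =>
    intro z
    have : coprimePart 1 (fun m => g (m * z)) = fun m => g (m * z) := by
      funext m; simp [coprimePart]
    rw [this, h z]
  | prime_mul p d hp ih =>
    have hdn : d ∣ n := (dvd_mul_left d p).trans hd
    have hpn : p ∣ n := (dvd_mul_right p d).trans hd
    intro z
    by_cases hpd : p ∣ d
    · rw [← ih hdn z]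
      congr 1
      funext m
      have : m.val.Coprime (p * d) ↔ m.val.Coprime d :=
        ⟨fun hm => hm.coprime_dvd_right (dvd_mul_left d p),
          fun hm => Nat.Coprime.mul_right (hm.coprime_dvd_right hpd) hm⟩
      simp only [coprimePart, this]
    · have hcop : p.Coprime d := hp.coprime_iff_not_dvd.2 hpd
      have key : ∀ s : ℂ, 1 < s.re → LFunction (coprimePart (p * d) fun m => g (m * z)) s
          = LFunction (coprimePart d fun m => g (m * z)) s
            - (p : ℂ) ^ (-s) * LFunction (coprimePart d fun m => g (m * ((p : ZMod n) * z))) s := by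
        intro s hs
        rw [LFunction_coprimePart_mul hp hpn hdn hcop _ hs]
        have : (fun m : ZMod n => g (p * m * z)) = fun m => g (m * ((p : ZMod n) * z)) := by
          funext m; congr 1; ring
        simp only [this]
      have hp0 : (p : ℂ) ≠ 0 := by exact_mod_cast hp.ne_zero
      have hpow : Tendsto (fun s : ℝ => (p : ℂ) ^ (-(s : ℂ))) (𝓝[>] 1) (𝓝 ((p : ℂ) ^ (-1 : ℂ))) := by
        have hc : Continuous fun s : ℝ => (p : ℂ) ^ (-(s : ℂ)) :=
          Complex.continuous_ofReal.neg.const_cpow (Or.inl hp0)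
        have := (hc.tendsto 1).mono_left (nhdsWithin_le_nhds (s := Set.Ioi 1))
        simpa using this
      have hr := (tendsto_LFunction_one (coprimePart_odd hdn (hodd z))).sub
        (hpow.mul (tendsto_LFunction_one (coprimePart_odd hdn (hodd (p * z)))))
      rw [ih hdn, ih hdn, mul_zero, sub_zero] at hr
      refine tendsto_nhds_unique (tendsto_LFunction_one (coprimePart_odd hd (hodd z)))
        (hr.congr' ?_)
      filter_upwards [self_mem_nhdsWithin] with s hs
      exact (key s (by simpa using hs)).symm

end EulerFactors

/-! ### Nonsingularity of the sawtooth matrix -/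

section Nonvanishing

open ZMod

variable {n : ℕ} [NeZero n]

theorem LFunction_const_mul (c : ℂ) (g : ZMod n → ℂ) (s : ℂ) :
    LFunction (fun m => c * g m) s = c * LFunction g s := by
  simp only [LFunction, Finset.mul_sum]
  exact Finset.sum_congr rfl fun j _ => by ring

theorem LFunction_finset_sum {ι : Type*} (t : Finset ι) (g : ι → ZMod n → ℂ) (s : ℂ) :
    LFunction (fun m => ∑ i ∈ t, g i m) s = ∑ i ∈ t, LFunction (g i) s := by
  simp only [LFunction, Finset.sum_mul]
  rw [Finset.sum_comm, Finset.mul_sum]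

/-- An odd function `g` on `ℤ/n` is zero as soon as the `L`-functions of all its dilates vanish
at `1`: for each odd character `χ`, the `χ`-component of `g` is killed by `L(1, χ) ≠ 0`. -/
theorem eq_zero_of_LFunction_one_eq_zero {g : ZMod n → ℂ} (hg : g.Odd)
    (h : ∀ z, LFunction (fun m => g (m * z)) 1 = 0) : g = 0 := by
  funext z
  have hcop := LFunction_coprimePart_eq_zero hg h dvd_rfl
  -- the `χ`-component of `g` along the orbit of `z` under the units
  set c : DirichletCharacter ℂ n → ℂ := fun χ => ∑ u : (ZMod n)ˣ, χ ↑u⁻¹ * g (u * z) with hc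
  have hunit : ∀ m : ZMod n, m.val.Coprime n ↔ IsUnit m := fun m => by
    rw [← ZMod.isUnit_iff_coprime, ZMod.natCast_zmod_val]
  have hzero : ∀ χ, c χ = 0 := by
    intro χ
    -- an even character has no component in an odd function
    rcases χ.even_or_odd with hχ | hχ
    · have h1 : c χ = -c χ := by
        rw [hc]
        simp only
        rw [← Finset.sum_neg_distrib, ← Equiv.sum_comp (Equiv.neg (ZMod n)ˣ)]
        refine Finset.sum_congr rfl fun u _ => ?_
        simp only [Equiv.neg_apply, inv_neg, Units.val_neg, neg_mul, hg _]
        rw [hχ.eval_neg, mul_neg]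
      exact self_eq_neg.1 h1
    · have hne : χ ≠ 1 := by
        rintro rfl
        have h1 : (1 : DirichletCharacter ℂ n) (-1) = -1 := hχ
        rw [MulChar.one_apply isUnit_one.neg] at h1
        norm_num at h1
      have hL : LFunction (fun m => χ m) 1 ≠ 0 := DirichletCharacter.LFunction_apply_one_ne_zero hne
      have h2 : (fun m : ZMod n => c χ * χ m)
          = fun m => ∑ u : (ZMod n)ˣ, χ ↑u⁻¹ * coprimePart n (fun m => g (m * ((u : ZMod n) * z))) m := by
        funext m
        by_cases hm : IsUnit m
        · obtain ⟨v, rfl⟩ := hm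
          rw [hc]
          simp only
          rw [← Equiv.sum_comp (Equiv.mulLeft v), Finset.sum_mul]
          refine Finset.sum_congr rfl fun u _ => ?_
          rw [coprimePart, if_pos ((hunit _).2 v.isUnit), Equiv.coe_mulLeft, mul_inv,
            Units.val_mul, map_mul, Units.val_mul]
          have h3 : χ ↑v⁻¹ * χ v = 1 := by
            rw [← map_mul, ← Units.val_mul, inv_mul_cancel, Units.val_one, map_one]
          rw [mul_assoc (v : ZMod n)]
          linear_combination (χ ↑u⁻¹ * g (v * (u * z))) * h3
        · rw [MulChar.map_nonunit _ hm, mul_zero]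
          refine (Finset.sum_eq_zero fun u _ => ?_).symm
          rw [coprimePart, if_neg (fun hh => hm ((hunit _).1 hh)), mul_zero]
      have h4 : c χ * LFunction (fun m => χ m) 1 = 0 := by
        rw [← LFunction_const_mul, h2, LFunction_finset_sum]
        refine Finset.sum_eq_zero fun u _ => ?_
        rw [LFunction_const_mul, hcop, mul_zero]
      exact (mul_eq_zero.1 h4).resolve_right hL
  -- by orthogonality `g z` is the average of its components
  have hsum : ∑ χ, c χ = n.totient * g z := by
    rw [hc]
    simp only
    rw [Finset.sum_comm]
    simp only [← Finset.sum_mul, DirichletCharacter.sum_characters_eq]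
    rw [Finset.sum_eq_single 1]
    · simp
    · intro u _ hu
      rw [if_neg, zero_mul]
      rw [← Units.val_one, Units.val_inj, inv_eq_one]
      exact hu
    · simp
  rw [Finset.sum_eq_zero fun χ _ => hzero χ] at hsum
  have ht : (n.totient : ℂ) ≠ 0 := by
    exact_mod_cast (Nat.totient_pos.2 (NeZero.pos n)).ne'
  exact (mul_eq_zero.1 hsum.symm).resolve_left ht

/-- The matrix `saw (z i)` is nonsingular on odd functions. -/
theorem eq_zero_of_sum_saw_eq_zero {f : ZMod n → ℂ} (hf : f.Odd)
    (h : ∀ z, ∑ i, f i * saw (z * i) = 0) : f = 0 := by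
  have hn : (n : ℂ) ≠ 0 := by exact_mod_cast NeZero.ne n
  have hodd : (𝓕 f).Odd := dft_odd_iff.2 hf
  suffices 𝓕 f = 0 from (LinearEquiv.map_eq_zero_iff _).1 this
  refine eq_zero_of_LFunction_one_eq_zero hodd fun z => ?_
  have hoddz : (fun m => 𝓕 f (m * z)).Odd := fun m => by
    show 𝓕 f (-m * z) = -𝓕 f (m * z)
    rw [neg_mul, hodd]
  rw [LFunction_one_of_odd hoddz]
  have hinv : ∀ u, saw u = (n : ℂ)⁻¹ * ∑ j, stdAddChar (j * u) * 𝓕 (saw : ZMod n → ℂ) j := by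
    intro u
    have := invDFT_apply (𝓕 (saw : ZMod n → ℂ)) u
    rwa [LinearEquiv.symm_apply_apply] at this
  have hkey : ∑ j, 𝓕 f (j * z) * 𝓕 (saw : ZMod n → ℂ) j = n * ∑ i, f i * saw (-z * i) := by
    simp only [hinv, dft_apply f, Finset.sum_mul, Finset.mul_sum]
    rw [Finset.sum_comm]
    refine Finset.sum_congr rfl fun i _ => Finset.sum_congr rfl fun j _ => ?_
    rw [show j * (-z * i) = -(i * (j * z)) by ring, smul_eq_mul]
    field_simp
  rw [hkey, h, mul_zero, mul_zero]

end Nonvanishing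

/-! ### The representation ring of a cyclic group -/

section Coefficients

open ZMod

variable {n : ℕ} [NeZero n]

/-- The virtual character `∑ c_z ρ_z` with integral coefficients `c`. -/
noncomputable def ofCoeff (n : ℕ) [NeZero n] : (ZMod n → ℤ) →+ RC (C n) where
  toFun c := ∑ j ∈ Finset.range n, c (j : ZMod n) • rhoChar n j
  map_zero' := by simp
  map_add' c c' := by simp [add_smul, Finset.sum_add_distrib]

theorem ofCoeff_apply (c : ZMod n → ℤ) (g : C n) :
    (ofCoeff n c : C n → ℂ) g = ∑ z : ZMod n, (c z : ℂ) * stdAddChar (z * Multiplicative.toAdd g) :=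
  coe_sum_smul c g

theorem ofCoeff_injective : Function.Injective (ofCoeff n) := by
  intro c c' h
  have h1 : 𝓕 (fun z => (c z : ℂ)) = 𝓕 (fun z => (c' z : ℂ)) := by
    funext a
    have := congrFun (congrArg Subtype.val h) (Multiplicative.ofAdd (-a))
    rw [ofCoeff_apply, ofCoeff_apply] at this
    simpa [dft_apply, mul_comm] using this
  funext z
  exact_mod_cast congrFun (dft.injective h1) z

/-- The averages of a character of `C n` against the characters `ρ_z` are integers, being dimensions
of spaces of invariants. -/
theorem exists_int_eq_dft_character {d : ℕ} (ρ : Representation ℂ (C n) (Fin d → ℂ)) (z : ZMod n) :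
    ∃ m : ℤ, (n : ℂ)⁻¹ * 𝓕 (fun a => ρ.character (Multiplicative.ofAdd a)) z = m := by
  let σ : Representation ℂ (C n) (Fin d → ℂ) :=
    { toFun := fun g => (stdAddChar (-(Multiplicative.toAdd g * z)) : ℂ) • ρ g
      map_one' := by simp
      map_mul' := by
        intro g h
        rw [toAdd_mul, add_mul, neg_add, AddChar.map_add_eq_mul, map_mul, smul_mul_smul_comm] }
  have : Invertible (Fintype.card (C n) : ℂ) :=
    invertibleOfNonzero (by exact_mod_cast Fintype.card_ne_zero)
  refine ⟨(Module.finrank ℂ (Representation.invariants σ) : ℕ), ?_⟩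
  have htr := (Representation.isProj_averageMap σ).trace
  rw [Int.cast_natCast, ← htr]
  simp only [Representation.averageMap, GroupAlgebra.average, _root_.map_smul, map_sum, invOf_eq_inv]
  have hcard : Fintype.card (C n) = n := by
    rw [Fintype.card_multiplicative, ZMod.card]
  rw [hcard, smul_eq_mul, dft_apply]
  congr 1
  refine Fintype.sum_equiv Multiplicative.ofAdd _ _ fun a => ?_
  simp [σ, Representation.character]

theorem ofCoeff_surjective : Function.Surjective (ofCoeff n) := by
  rintro ⟨a, ha⟩
  suffices h : ∃ c, (ofCoeff n c : C n → ℂ) = a by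
    obtain ⟨c, hc⟩ := h
    exact ⟨c, Subtype.ext hc⟩
  induction ha using AddSubgroup.closure_induction with
  | mem χ h =>
    obtain ⟨d, ρ, rfl⟩ := h
    choose c hc using exists_int_eq_dft_character ρ
    refine ⟨c, ?_⟩
    funext g
    rw [ofCoeff_apply]
    have hinv := invDFT_apply (𝓕 fun a => ρ.character (Multiplicative.ofAdd a))
      (Multiplicative.toAdd g)
    rw [LinearEquiv.symm_apply_apply] at hinv
    simp only [ofAdd_toAdd] at hinv
    rw [hinv, smul_eq_mul, Finset.mul_sum]
    refine Finset.sum_congr rfl fun z _ => ?_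
    rw [← hc, smul_eq_mul]; ring
  | zero => exact ⟨0, by simp⟩
  | add a b _ _ ha hb =>
    obtain ⟨c, rfl⟩ := ha
    obtain ⟨c', rfl⟩ := hb
    exact ⟨c + c', by simp⟩
  | neg a _ ha =>
    obtain ⟨c, rfl⟩ := ha
    exact ⟨-c, by simp⟩

/-- The representation ring of `C n` is free on the characters `ρ_z`, `z ∈ ℤ/n`. -/
noncomputable def coeffEquiv (n : ℕ) [NeZero n] : (ZMod n → ℤ) ≃+ RC (C n) :=
  AddEquiv.ofBijective (ofCoeff n) ⟨ofCoeff_injective, ofCoeff_surjective⟩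

theorem coeffEquiv_symm_ofCoeff (c : ZMod n → ℤ) : (coeffEquiv n).symm (ofCoeff n c) = c :=
  (coeffEquiv n).symm_apply_apply c

theorem conjRC_ofCoeff (c : ZMod n → ℤ) :
    conjRC (ofCoeff n c) = ofCoeff n fun z => c (-z) := by
  apply Subtype.ext
  funext g
  show starRingEnd ℂ ((ofCoeff n c : C n → ℂ) g) = _
  rw [ofCoeff_apply, ofCoeff_apply, map_sum, ← Equiv.sum_comp (Equiv.neg (ZMod n))]
  refine Finset.sum_congr rfl fun z _ => ?_
  rw [map_mul, Equiv.neg_apply, neg_mul, AddChar.map_neg_eq_conj, Complex.conj_conj, map_intCast]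

theorem conjRC_indChar {G : Type} [Group G] [Finite G] (H : Subgroup G) :
    conjRC (indChar G H) = indChar G H := by
  apply Subtype.ext
  funext g
  show starRingEnd ℂ ((Representation.ind _ _).character g) = (Representation.ind _ _).character g
  rw [ind_char, map_natCast]

end Coefficients

/-! ### Odd integral functions on `ℤ/n` -/

section OddFunctions

variable {n : ℕ}

/-- The lattice of odd integral functions on `ℤ/n`. -/
def OddFun (n : ℕ) : Submodule ℤ (ZMod n → ℤ) where
  carrier := {f | ∀ z, f (-z) = -f z}
  zero_mem' := by simp
  add_mem' := by
    intro f g hf hg z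
    rw [Pi.add_apply, Pi.add_apply, hf z, hg z, neg_add]
  smul_mem' := by
    intro c f hf z
    rw [Pi.smul_apply, Pi.smul_apply, hf z, smul_neg]

/-- Twice the odd part of an integral function on `ℤ/n`. -/
def oddify (n : ℕ) : (ZMod n → ℤ) →+ OddFun n where
  toFun c := ⟨fun z => c z - c (-z), fun z => by
    show c (-z) - c (- -z) = -(c z - c (-z))
    rw [neg_neg, neg_sub]⟩
  map_zero' := by ext; simp
  map_add' c c' := by
    ext z
    simp only [Pi.add_apply, Submodule.coe_add]
    ring

theorem oddify_apply (c : ZMod n → ℤ) (z : ZMod n) :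
    (oddify n c : ZMod n → ℤ) z = c z - c (-z) := rfl

theorem oddify_coe (f : OddFun n) : oddify n f = (2 : ℤ) • f := by
  ext z
  rw [oddify_apply, f.2 z]
  simp [two_mul]

variable [NeZero n]

/-- Odd functions on `ℤ/n` are determined by their values at `1, …, (n - 1) / 2`, which are
arbitrary. -/
theorem finrank_oddFun : Module.finrank ℤ (OddFun n) = (n - 1) / 2 := by
  set r := (n - 1) / 2 with hr
  have hn := NeZero.pos n
  refine le_antisymm ?_ ?_
  · let res : OddFun n →ₗ[ℤ] (Fin r → ℤ) :=
      { toFun := fun f k => (f : ZMod n → ℤ) ((k + 1 : ℕ) : ZMod n)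
        map_add' := fun _ _ => rfl
        map_smul' := fun _ _ => rfl }
    have hres : Function.Injective res := by
      refine (injective_iff_map_eq_zero res).2 fun f hf => ?_
      have hsmall : ∀ k, 1 ≤ k → k ≤ r → (f : ZMod n → ℤ) (k : ZMod n) = 0 := by
        intro k h1 h2
        obtain ⟨k, rfl⟩ := Nat.exists_eq_add_of_le' h1
        exact congrFun hf ⟨k, by omega⟩
      ext z
      show (f : ZMod n → ℤ) z = 0
      have hlt := ZMod.val_lt z
      have hselfneg : -z = z → (f : ZMod n → ℤ) z = 0 := by
        intro h
        have := f.2 z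
        rw [h] at this
        omega
      by_cases hz : z = 0
      · exact hselfneg (by simp [hz])
      have hv : z.val ≠ 0 := fun h => hz ((ZMod.val_eq_zero z).1 h)
      by_cases h1 : z.val ≤ r
      · rw [← ZMod.natCast_zmod_val z]
        exact hsmall _ (by omega) h1
      by_cases h2 : 2 * z.val = n
      · exact hselfneg (ZMod.neg_eq_self_iff z |>.2 (Or.inr h2))
      · have hneg : -z = ((n - z.val : ℕ) : ZMod n) := by
          rw [Nat.cast_sub hlt.le, ZMod.natCast_self, zero_sub, ZMod.natCast_zmod_val]
        have := f.2 z
        rw [hneg, hsmall _ (by omega) (by omega)] at this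
        omega
    simpa using LinearMap.finrank_le_finrank_of_injective hres
  · let ext0 : (Fin r → ℤ) → ℕ → ℤ := fun g k => if h : 1 ≤ k ∧ k ≤ r then g ⟨k - 1, by omega⟩ else 0
    let ext1 : (Fin r → ℤ) →ₗ[ℤ] OddFun n :=
      { toFun := fun g => oddify n fun z => ext0 g z.val
        map_add' := by
          intro g g'
          rw [← map_add]
          congr 1
          funext z
          simp only [ext0, Pi.add_apply]
          split_ifs <;> simp
        map_smul' := by
          intro c g
          rw [RingHom.id_apply, ← map_zsmul]
          congr 1
          funext z
          simp only [ext0, Pi.smul_apply]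
          split_ifs <;> simp }
    have hext : Function.Injective ext1 := by
      refine (injective_iff_map_eq_zero ext1).2 fun g hg => ?_
      funext k
      have hk := k.2
      have hk1 : k.1 + 1 < n := by omega
      have h0 : ((k.1 + 1 : ℕ) : ZMod n) ≠ 0 := by
        rw [Ne, ZMod.natCast_eq_zero_iff]
        exact Nat.not_dvd_of_pos_of_lt (by omega) hk1
      have : NeZero ((k.1 + 1 : ℕ) : ZMod n) := ⟨h0⟩
      have h1 : (ext1 g : ZMod n → ℤ) ((k.1 + 1 : ℕ) : ZMod n) = 0 := by rw [hg]; rfl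
      have h2 : (ext1 g : ZMod n → ℤ) ((k.1 + 1 : ℕ) : ZMod n)
          = ext0 g ((k.1 + 1 : ℕ) : ZMod n).val - ext0 g (-((k.1 + 1 : ℕ) : ZMod n)).val := rfl
      rw [h2, ZMod.val_neg_of_ne_zero, ZMod.val_cast_of_lt hk1] at h1
      have h3 : ¬ (1 ≤ n - (k.1 + 1) ∧ n - (k.1 + 1) ≤ r) := by omega
      have h4 : 1 ≤ k.1 + 1 ∧ k.1 + 1 ≤ r := by omega
      simp only [ext0, dif_neg h3, dif_pos h4, sub_zero] at h1
      simpa using h1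
    simpa using LinearMap.finrank_le_finrank_of_injective hext

end OddFunctions

/-! ### The group of singular orbit data -/

section OrbitData

variable {n : ℕ}

/-- A cyclic group has at most one involution. -/
theorem eq_of_inv_eq_self [NeZero n] {γ δ : C n} (hγ : γ⁻¹ = γ) (hγ1 : γ ≠ 1) (hδ : δ⁻¹ = δ) (hδ1 : δ ≠ 1) :
    γ = δ := by
  have key : ∀ ε : C n, ε⁻¹ = ε → ε ≠ 1 → 2 * (Multiplicative.toAdd ε).val = n := by
    intro ε h h1
    exact ((ZMod.neg_eq_self_iff (Multiplicative.toAdd ε)).1 h).resolve_left h1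
  have h1 := key γ hγ hγ1
  have h2 := key δ hδ hδ1
  exact ZMod.val_injective n (by omega : (Multiplicative.toAdd γ).val = (Multiplicative.toAdd δ).val)

theorem map_inv_pair (γ : C n) :
    ({γ, γ⁻¹} : Multiset (C n)).map (fun γ => γ⁻¹) = {γ, γ⁻¹} := by
  simp only [Multiset.insert_eq_cons, Multiset.map_cons, Multiset.map_singleton, inv_inv]
  exact Multiset.pair_comm _ _

theorem mk_add_pair {γ : C n} {t : Multiset (C n)} (h : {γ, γ⁻¹} + t ∈ orbitData (C n))
    (ht : t ∈ orbitData (C n)) : 𝔹.mk ⟨{γ, γ⁻¹} + t, h⟩ = 𝔹.mk ⟨t, ht⟩ := by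
  have h1 : ({γ, γ⁻¹} : Multiset (C n)) ∈ orbitData (C n) := by
    show Multiset.prod _ = 1
    simp
  have h2 : (⟨{γ, γ⁻¹} + t, h⟩ : orbitData (C n)) = ⟨_, h1⟩ + ⟨t, ht⟩ := rfl
  rw [h2, map_add, 𝔹.mk_eq_of_zeroRel ⟨rfl, Or.inr ⟨γ, rfl⟩⟩, map_zero, zero_add]

theorem mk_add_one {t : Multiset (C n)} (h : {1} + t ∈ orbitData (C n))
    (ht : t ∈ orbitData (C n)) : 𝔹.mk ⟨{1} + t, h⟩ = 𝔹.mk ⟨t, ht⟩ := by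
  have h1 : ({1} : Multiset (C n)) ∈ orbitData (C n) := by
    show Multiset.prod _ = 1
    simp
  have h2 : (⟨{1} + t, h⟩ : orbitData (C n)) = ⟨_, h1⟩ + ⟨t, ht⟩ := rfl
  rw [h2, map_add, 𝔹.mk_eq_of_zeroRel ⟨rfl, Or.inl rfl⟩, map_zero, zero_add]

/-- A singular orbit datum that is invariant under inversion is trivial. Since `C n` has at most one
involution `τ`, such a datum consists of entries `1`, cancelling pairs, and copies of `τ`, whose
number is even because the product of all entries is `1`. -/
theorem mk_eq_zero_of_map_inv_eq [NeZero n] (s : Multiset (C n)) (hs : s.map (fun γ => γ⁻¹) = s) :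
    ∀ h : s ∈ orbitData (C n), 𝔹.mk ⟨s, h⟩ = 0 := by
  induction s using Multiset.strongInductionOn with
  | ih s ih =>
  intro h
  have hpair : ∀ γ t, s = {γ, γ⁻¹} + t → 𝔹.mk ⟨s, h⟩ = 0 := by
    rintro γ t rfl
    have ht : t ∈ orbitData (C n) := by
      have : Multiset.prod ({γ, γ⁻¹} + t) = 1 := h
      show t.prod = 1
      simpa [Multiset.prod_add] using this
    have hts : t.map (fun γ => γ⁻¹) = t := by
      rw [Multiset.map_add] at hs
      rw [map_inv_pair] at hs
      exact add_left_cancel hs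
    rw [mk_add_pair h ht]
    exact ih t (Multiset.lt_iff_cons_le.2 ⟨γ, by
      simp only [Multiset.insert_eq_cons, Multiset.cons_add, Multiset.singleton_add]
      exact (Multiset.cons_le_cons_iff γ).2 (Multiset.le_cons_self _ _)⟩) hts ht
  by_cases h1 : (1 : C n) ∈ s
  · obtain ⟨t, rfl⟩ := Multiset.exists_cons_of_mem h1
    have ht : t ∈ orbitData (C n) := by
      have : Multiset.prod (1 ::ₘ t) = 1 := h
      show t.prod = 1
      simpa using this
    have hts : t.map (fun γ => γ⁻¹) = t := by
      rw [Multiset.map_cons, inv_one] at hs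
      exact (Multiset.cons_inj_right 1).1 hs
    exact (mk_add_one h ht).trans (ih t (Multiset.lt_cons_self t 1) hts ht)
  rcases Multiset.empty_or_exists_mem s with rfl | ⟨γ, hγ⟩
  · exact map_zero 𝔹.mk
  obtain ⟨t, rfl⟩ := Multiset.exists_cons_of_mem hγ
  -- either some entry cancels against another one, or `γ` is an involution and the only entry
  by_cases hinv : γ⁻¹ ∈ t
  · obtain ⟨t', rfl⟩ := Multiset.exists_cons_of_mem hinv
    exact hpair γ t' (by simp [Multiset.insert_eq_cons])
  have hmem : ∀ δ ∈ γ ::ₘ t, δ⁻¹ ∈ γ ::ₘ t := fun δ hδ => by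
    rw [← hs]
    exact Multiset.mem_map_of_mem _ hδ
  have hγself : γ⁻¹ = γ := (Multiset.mem_cons.1 (hmem γ hγ)).resolve_right hinv
  have hγ1 : γ ≠ 1 := fun hh => h1 (hh ▸ hγ)
  rcases Multiset.empty_or_exists_mem t with rfl | ⟨δ, hδ⟩
  · have : Multiset.prod (γ ::ₘ 0) = 1 := h
    exact absurd (by simpa using this) hγ1
  · have hδ1 : δ ≠ 1 := fun hh => h1 (hh ▸ Multiset.mem_cons_of_mem hδ)
    have hδγ : δ ≠ γ := fun hh => hinv (by rw [hγself, ← hh]; exact hδ)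
    have hδself : δ⁻¹ ≠ δ := fun hh => hδγ (eq_of_inv_eq_self hh hδ1 hγself hγ1)
    obtain ⟨u, hu⟩ := Multiset.exists_cons_of_mem (Multiset.mem_cons_of_mem hδ : δ ∈ γ ::ₘ t)
    have hδu : δ⁻¹ ∈ u := by
      have := hmem δ (Multiset.mem_cons_of_mem hδ)
      rw [hu] at this
      exact (Multiset.mem_cons.1 this).resolve_left hδself
    obtain ⟨u', rfl⟩ := Multiset.exists_cons_of_mem hδu
    exact hpair δ u' (by rw [hu]; simp [Multiset.insert_eq_cons])

/-- The multiplicities of the entries of a multiset in `C n`. -/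
noncomputable def entryCount (n : ℕ) : Multiset (C n) →+ (ZMod n → ℤ) where
  toFun s i := (s.count (Multiplicative.ofAdd i) : ℕ)
  map_zero' := by funext i; simp
  map_add' s t := by funext i; simp

theorem entryCount_map_inv (s : Multiset (C n)) (i : ZMod n) :
    entryCount n (s.map fun γ => γ⁻¹) i = entryCount n s (-i) := by
  have := Multiset.count_map_eq_count' (fun γ : C n => γ⁻¹) s inv_injective
    (Multiplicative.ofAdd (-i))
  rw [← ofAdd_neg, neg_neg] at this
  show ((Multiset.count _ _ : ℕ) : ℤ) = (Multiset.count _ _ : ℕ)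
  rw [this]

/-- The homomorphism sending `[γ₁, …, γ_q]` to the odd function counting each `γ` among the entries
with sign `1` and each `γ⁻¹` with sign `-1`. -/
noncomputable def signedCount (n : ℕ) [NeZero n] : 𝔹 (C n) →+ OddFun n :=
  𝔹.lift (((oddify n).comp (entryCount n)).comp (orbitData (C n)).subtype) (by
    rintro s t ⟨rfl, hs⟩
    rw [map_zero]
    have hinv : (s : Multiset (C n)).map (fun γ => γ⁻¹) = s := by
      rcases hs with hs | ⟨γ, hs⟩
      · rw [hs]; simp
      · rw [hs, map_inv_pair]
    ext i
    show entryCount n s i - entryCount n s (-i) = 0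
    rw [← entryCount_map_inv, hinv, sub_self])

variable [NeZero n]

theorem signedCount_mk (s : orbitData (C n)) (i : ZMod n) :
    (signedCount n (𝔹.mk s) : ZMod n → ℤ) i = entryCount n s i - entryCount n s (-i) := rfl

theorem signedCount_injective : Function.Injective (signedCount n) := by
  refine (injective_iff_map_eq_zero _).2 fun b hb => ?_
  obtain ⟨s, rfl⟩ := 𝔹.mk_surjective b
  refine mk_eq_zero_of_map_inv_eq (s : Multiset (C n)) ?_ s.2
  ext γ
  have h : (signedCount n (𝔹.mk s) : ZMod n → ℤ) (Multiplicative.toAdd γ) = 0 := by rw [hb]; rfl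
  rw [signedCount_mk, ← entryCount_map_inv, sub_eq_zero] at h
  have h' : (Multiset.count γ (s : Multiset (C n)) : ℤ)
      = Multiset.count γ ((s : Multiset (C n)).map fun γ => γ⁻¹) := h
  exact_mod_cast h'.symm

/-- The datum `[x ^ i, …, x ^ i]` with `n` entries. -/
def constDatum (i : ZMod n) : orbitData (C n) :=
  ⟨Multiset.replicate n (Multiplicative.ofAdd i), by
    show Multiset.prod _ = 1
    rw [Multiset.prod_replicate, ← ofAdd_nsmul, nsmul_eq_mul, ZMod.natCast_self, zero_mul,
      ofAdd_zero]⟩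

/-- The image of `signedCount` contains `2n` times the lattice of odd functions. -/
theorem signedCount_sum_constDatum (f : OddFun n) :
    signedCount n (∑ i, (f : ZMod n → ℤ) i • 𝔹.mk (constDatum i)) = (2 * n : ℤ) • f := by
  have h : ∀ i j : ZMod n, (signedCount n (𝔹.mk (constDatum i)) : ZMod n → ℤ) j
      = (if i = j then (n : ℤ) else 0) - if i = -j then (n : ℤ) else 0 := by
    intro i j
    have hc : ∀ j : ZMod n, entryCount n (constDatum i : Multiset (C n)) j
        = if i = j then (n : ℤ) else 0 := by
      intro j
      show ((Multiset.count _ (Multiset.replicate _ _) : ℕ) : ℤ) = _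
      rw [Multiset.count_replicate]
      simp
    rw [signedCount_mk, hc, hc]
  ext j
  rw [map_sum]
  simp only [map_zsmul, Submodule.coe_sum, Finset.sum_apply, SetLike.val_smul, Pi.smul_apply, h,
    smul_eq_mul, mul_sub, mul_ite, mul_zero, Finset.sum_sub_distrib, Finset.sum_ite_eq',
    Finset.mem_univ, if_true, f.2 j]
  ring

end OrbitData

/-! ### The homomorphism `θ` on odd parts -/

section Theta

variable {n : ℕ} [NeZero n]

/-- Twice the odd part of the multiplicities of a virtual character; it vanishes on `D`. -/
noncomputable def oddMult (n : ℕ) [NeZero n] : RC (C n) ⧸ D (C n) →+ OddFun n :=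
  QuotientAddGroup.lift (D (C n)) ((oddify n).comp (coeffEquiv n).symm.toAddMonoidHom) (by
    rw [D, AddSubgroup.closure_le]
    rintro _ ⟨H, rfl⟩
    obtain ⟨c, hc⟩ := ofCoeff_surjective (indChar (C n) H)
    have h1 : c = fun z => c (-z) := by
      apply ofCoeff_injective
      rw [← conjRC_ofCoeff, hc, conjRC_indChar]
    show oddify n ((coeffEquiv n).symm (indChar (C n) H)) = 0
    rw [← hc, coeffEquiv_symm_ofCoeff]
    ext z
    exact sub_eq_zero.2 (congrFun h1 z))

theorem oddMult_ofCoeff (c : ZMod n → ℤ) :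
    oddMult n (ofCoeff n c : RC (C n)) = oddify n c := by
  show oddify n ((coeffEquiv n).symm (ofCoeff n c)) = _
  rw [coeffEquiv_symm_ofCoeff]

theorem exists_ofCoeff (a : RC (C n) ⧸ D (C n)) : ∃ c, (ofCoeff n c : RC (C n) ⧸ D (C n)) = a := by
  obtain ⟨b, rfl⟩ := QuotientAddGroup.mk_surjective a
  obtain ⟨c, rfl⟩ := ofCoeff_surjective b
  exact ⟨c, rfl⟩

theorem conjQ_ofCoeff (c : ZMod n → ℤ) :
    conjQ (C n) (ofCoeff n c : RC (C n)) = (ofCoeff n fun z => c (-z) : RC (C n)) := by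
  rw [← conjRC_ofCoeff]; rfl

theorem theta_mk_eq_ofCoeff (s : orbitData (C n)) :
    theta n (𝔹.mk s) = (ofCoeff n (baseMult (s : Multiset (C n))) : RC (C n) ⧸ D (C n)) := by
  rw [theta_mk 1, mk_phi]; rfl

theorem conjQ_theta (b : 𝔹 (C n)) : conjQ (C n) (theta n b) = theta n (-b) := by
  obtain ⟨s, rfl⟩ := 𝔹.mk_surjective b
  rw [𝔹.neg_mk, theta_mk_eq_ofCoeff, theta_mk_eq_ofCoeff, conjQ_ofCoeff, orbitData.coe_inv]
  congr 2
  funext z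
  simp [baseMult, Multiset.map_map]

theorem theta_range_le : (theta n).range ≤ 𝔸 (C n) := by
  rintro _ ⟨b, rfl⟩
  show theta n b + conjQ (C n) (theta n b) = 0
  rw [conjQ_theta, ← map_add, add_neg_cancel, map_zero]

/-- Up to an even function of `u`, the weight of `u` is `-n` times the sawtooth function. -/
theorem wt_eq_saw (u : ZMod n) :
    (wt u : ℂ) = n * (1 / 2 - saw u + if u = 0 then 1 / 2 else 0) := by
  have hn : (n : ℂ) ≠ 0 := by exact_mod_cast NeZero.ne n
  unfold wt saw
  split_ifs
  · ring
  · field_simp; ring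

theorem baseMult_sub_baseMult_neg (s : orbitData (C n)) (z : ZMod n) :
    ((baseMult (s : Multiset (C n)) z - baseMult (s : Multiset (C n)) (-z) : ℤ) : ℂ)
      = 2 * ((s : Multiset (C n)).map fun γ => saw (z * Multiplicative.toAdd γ)).sum := by
  have hn : (n : ℂ) ≠ 0 := by exact_mod_cast NeZero.ne n
  have hn' : (n : ℤ) ≠ 0 := by exact_mod_cast NeZero.ne n
  have hbase : ∀ z : ZMod n, (n : ℂ) * baseMult (s : Multiset (C n)) z
      = n * Multiset.card (s : Multiset (C n))
        - ((s : Multiset (C n)).map fun γ => (wt (z * Multiplicative.toAdd γ) : ℂ)).sum := by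
    intro z
    obtain ⟨m, hm⟩ := dvd_sum s.2 z
    have hcast : ((s : Multiset (C n)).map fun γ => (wt (z * Multiplicative.toAdd γ) : ℂ)).sum
        = (n * m : ℕ) := by
      rw [← hm, Nat.cast_multiset_sum, Multiset.map_map]; rfl
    rw [hcast, baseMult, hm]
    push_cast
    rw [Int.mul_ediv_cancel_left _ hn']
    push_cast
    ring
  -- the even summands `1/2` and `[u = 0]/2` of `wt u / n` cancel in the difference
  have hdiff : ∀ t : Multiset (C n),
      (t.map fun γ => (wt (-z * Multiplicative.toAdd γ) : ℂ)).sum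
        - (t.map fun γ => (wt (z * Multiplicative.toAdd γ) : ℂ)).sum
      = n * (2 * (t.map fun γ => saw (z * Multiplicative.toAdd γ)).sum) := by
    intro t
    induction t using Multiset.induction_on with
    | empty => simp
    | cons γ t ih =>
      simp only [Multiset.map_cons, Multiset.sum_cons]
      rw [mul_add, mul_add, ← ih, wt_eq_saw, wt_eq_saw (z * _), neg_mul, saw_odd]
      simp only [neg_eq_zero]
      ring
  apply mul_left_cancel₀ hn
  rw [← hdiff]
  push_cast
  rw [mul_sub, hbase, hbase]
  ring

theorem sum_map_eq_sum_entryCount (s : Multiset (C n)) (F : ZMod n → ℂ) :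
    (s.map fun γ => F (Multiplicative.toAdd γ)).sum = ∑ i, (entryCount n s i : ℂ) * F i := by
  induction s using Multiset.induction_on with
  | empty => simp
  | cons γ s ih =>
    have h : ∀ i, entryCount n (γ ::ₘ s) i
        = entryCount n s i + if i = Multiplicative.toAdd γ then 1 else 0 := by
      intro i
      show ((Multiset.count _ _ : ℕ) : ℤ) = (Multiset.count _ _ : ℕ) + _
      rw [Multiset.count_cons]
      push_cast
      rfl
    rw [Multiset.map_cons, Multiset.sum_cons, ih]
    simp only [h]
    push_cast
    simp [add_mul, Finset.sum_add_distrib, add_comm]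

/-- On odd parts, `θ` is the matrix of the sawtooth function. -/
theorem oddMult_theta (b : 𝔹 (C n)) (z : ZMod n) :
    ((oddMult n (theta n b) : ZMod n → ℤ) z : ℂ)
      = ∑ i, ((signedCount n b : ZMod n → ℤ) i : ℂ) * saw (z * i) := by
  obtain ⟨s, rfl⟩ := 𝔹.mk_surjective b
  rw [theta_mk_eq_ofCoeff, oddMult_ofCoeff, oddify_apply, baseMult_sub_baseMult_neg,
    sum_map_eq_sum_entryCount (s : Multiset (C n)) fun i => saw (z * i)]
  have hneg : ∑ i, (entryCount n (s : Multiset (C n)) (-i) : ℂ) * saw (z * i)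
      = -∑ i, (entryCount n (s : Multiset (C n)) i : ℂ) * saw (z * i) := by
    rw [← Equiv.sum_comp (Equiv.neg (ZMod n)), ← Finset.sum_neg_distrib]
    refine Finset.sum_congr rfl fun i _ => ?_
    rw [Equiv.neg_apply, neg_neg, mul_neg z, saw_odd, mul_neg]
  simp only [signedCount_mk, Int.cast_sub, sub_mul, Finset.sum_sub_distrib]
  rw [hneg]
  ring

theorem theta_injective : Function.Injective (theta n) := by
  refine (injective_iff_map_eq_zero _).2 fun b hb => ?_
  apply signedCount_injective
  rw [map_zero]
  have h := eq_zero_of_sum_saw_eq_zero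
    (f := fun i => ((signedCount n b : ZMod n → ℤ) i : ℂ))
    (fun i => by
      show (((signedCount n b : ZMod n → ℤ) (-i) : ℤ) : ℂ) = -_
      rw [(signedCount n b).2 i, Int.cast_neg]) (fun z => by
      rw [← oddMult_theta, hb, map_zero]; simp)
  ext i
  exact Int.cast_eq_zero.1 (congrFun h i)

end Theta

/-! ### Ranks and the index of the image -/

section Rank

variable {n : ℕ} [NeZero n]

/-- A homomorphism with torsion kernel does not lower the rank. -/
theorem finrank_le_of_torsion_ker {M N : Type*} [AddCommGroup M] [AddCommGroup N]
    [Module.Finite ℤ M] [Module.Finite ℤ N] (f : M →+ N) (m : ℤ) (hm : m ≠ 0)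
    (hf : ∀ a, f a = 0 → m • a = 0) : Module.finrank ℤ M ≤ Module.finrank ℤ N := by
  let F := f.toIntLinearMap
  have hker : Module.finrank ℤ (LinearMap.ker F) = 0 := by
    rw [Module.finrank_eq_zero_iff_isTorsion]
    intro a
    exact ⟨⟨m, mem_nonZeroDivisors_of_ne_zero hm⟩, Subtype.ext (hf a a.2)⟩
  have h1 := Submodule.finrank_quotient_add_finrank (LinearMap.ker F)
  rw [hker, add_zero, F.quotKerEquivRange.finrank_eq] at h1
  rw [← h1]
  exact Submodule.finrank_le _

theorem finiteIndex_range_of_finrank_le {M N : Type*} [AddCommGroup M] [AddCommGroup N]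
    [Module.Finite ℤ N] (f : M →+ N) (hf : Function.Injective f)
    (h : Module.finrank ℤ N ≤ Module.finrank ℤ M) : f.range.FiniteIndex := by
  let F := f.toIntLinearMap
  have h1 := Submodule.finrank_quotient_add_finrank (LinearMap.range F)
  rw [LinearMap.finrank_range_of_inj (f := F) hf] at h1
  have h2 : Module.finrank ℤ (N ⧸ LinearMap.range F) = 0 := by omega
  have h3 : Finite (N ⧸ LinearMap.range F) :=
    Module.finite_of_fg_torsion _ (Module.finrank_eq_zero_iff_isTorsion.1 h2)
  have h4 : Finite (N ⧸ f.range) := h3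
  exact AddSubgroup.finiteIndex_of_finite_quotient

instance : Module.Finite ℤ (RC (C n) ⧸ D (C n)) :=
  Module.Finite.of_surjective
    ((QuotientAddGroup.mk' (D (C n))).comp (ofCoeff n)).toIntLinearMap fun a => exists_ofCoeff a

instance : Module.Finite ℤ (𝔸 (C n)) :=
  Module.Finite.of_injective (𝔸 (C n)).subtype.toIntLinearMap Subtype.val_injective

theorem finrank_𝔹 : Module.finrank ℤ (𝔹 (C n)) = Module.finrank ℤ (OddFun n) := by
  have hfin : Module.Finite ℤ (𝔹 (C n)) :=
    Module.Finite.of_injective (signedCount n).toIntLinearMap signedCount_injective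
  refine le_antisymm (finrank_le_of_torsion_ker (signedCount n) 1 one_ne_zero fun a ha => ?_) ?_
  · rw [one_smul]
    exact signedCount_injective (ha.trans (map_zero _).symm)
  · let g : OddFun n →+ 𝔹 (C n) :=
      { toFun := fun f => ∑ i, (f : ZMod n → ℤ) i • 𝔹.mk (constDatum i)
        map_zero' := by simp
        map_add' := fun f f' => by simp [add_smul, Finset.sum_add_distrib] }
    refine finrank_le_of_torsion_ker g (2 * n)
      (mul_ne_zero two_ne_zero (by exact_mod_cast NeZero.ne n)) fun f hf => ?_
    rw [← signedCount_sum_constDatum]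
    exact (congrArg (signedCount n) hf).trans (map_zero _)

theorem finrank_𝔸 : Module.finrank ℤ (𝔸 (C n)) = Module.finrank ℤ (OddFun n) := by
  refine le_antisymm ?_ ?_
  · refine finrank_le_of_torsion_ker ((oddMult n).comp (𝔸 (C n)).subtype) 2 two_ne_zero ?_
    rintro ⟨a, ha⟩ h
    obtain ⟨c, rfl⟩ := exists_ofCoeff a
    have h1 : oddMult n (ofCoeff n c : RC (C n)) = 0 := h
    have h2 : (fun z => c (-z)) = c := by
      rw [oddMult_ofCoeff] at h1
      funext z
      have h3 : (oddify n c : ZMod n → ℤ) z = 0 := by rw [h1]; rfl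
      rw [oddify_apply] at h3
      exact (sub_eq_zero.1 h3).symm
    apply Subtype.ext
    show (2 : ℤ) • (ofCoeff n c : RC (C n) ⧸ D (C n)) = 0
    have h3 : (ofCoeff n c : RC (C n) ⧸ D (C n)) + conjQ (C n) (ofCoeff n c : RC (C n)) = 0 := ha
    rwa [conjQ_ofCoeff, h2, ← two_zsmul] at h3
  · let g : OddFun n →+ 𝔸 (C n) :=
      ((QuotientAddGroup.mk' (D (C n))).comp
        ((ofCoeff n).comp (OddFun n).toAddSubgroup.subtype)).codRestrict (𝔸 (C n)) (by
        intro f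
        show (ofCoeff n (f : ZMod n → ℤ) : RC (C n) ⧸ D (C n))
          + conjQ (C n) (ofCoeff n (f : ZMod n → ℤ) : RC (C n)) = 0
        rw [conjQ_ofCoeff, ← QuotientAddGroup.mk_add, ← map_add]
        have : ((f : ZMod n → ℤ) + fun z => (f : ZMod n → ℤ) (-z)) = 0 := by
          funext z
          rw [Pi.add_apply, f.2 z, add_neg_cancel]; rfl
        rw [this, map_zero]; rfl)
    refine finrank_le_of_torsion_ker g 2 two_ne_zero fun f hf => ?_
    rw [← oddify_coe, ← oddMult_ofCoeff]
    have : ((ofCoeff n (f : ZMod n → ℤ) : RC (C n)) : RC (C n) ⧸ D (C n)) = 0 :=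
      congrArg Subtype.val hf
    rw [this, map_zero]

theorem theta_finiteIndex : ((theta n).range.addSubgroupOf (𝔸 (C n))).FiniteIndex := by
  let f : 𝔹 (C n) →+ 𝔸 (C n) := (theta n).codRestrict (𝔸 (C n)) fun b => theta_range_le ⟨b, rfl⟩
  have hf : Function.Injective f := fun a b h => theta_injective (congrArg Subtype.val h)
  have h := finiteIndex_range_of_finrank_le f hf (by rw [finrank_𝔸, finrank_𝔹])
  have heq : (theta n).range.addSubgroupOf (𝔸 (C n)) = f.range := by
    ext a
    constructor
    · rintro ⟨b, hb⟩
      exact ⟨b, Subtype.ext hb⟩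
    · rintro ⟨b, rfl⟩
      exact ⟨b, rfl⟩
  rwa [heq]

theorem rank_𝔸 : Module.rank ℤ (𝔸 (C n)) = (((n - 1) / 2 : ℕ) : Cardinal) := by
  rw [← Module.finrank_eq_rank, finrank_𝔸, finrank_oddFun]

end Rank

end SingularOrbit

theorem mainTheorem4 (n : ℕ) [NeZero n] :
    Function.Injective (SingularOrbit.theta n) ∧
    (SingularOrbit.theta n).range ≤ SingularOrbit.𝔸 (SingularOrbit.C n) ∧
    ((SingularOrbit.theta n).range.addSubgroupOf
      (SingularOrbit.𝔸 (SingularOrbit.C n))).FiniteIndex ∧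
    (Odd n → Module.rank ℤ (SingularOrbit.𝔸 (SingularOrbit.C n)) = (((n - 1) / 2 : ℕ) : Cardinal)) ∧
    (Even n → Module.rank ℤ (SingularOrbit.𝔸 (SingularOrbit.C n)) = ((n / 2 - 1 : ℕ) : Cardinal)) := by
  refine ⟨SingularOrbit.theta_injective, SingularOrbit.theta_range_le,
    SingularOrbit.theta_finiteIndex, fun _ => SingularOrbit.rank_𝔸, fun h => ?_⟩
  rw [SingularOrbit.rank_𝔸]
  obtain ⟨m, rfl⟩ := h
  congr 1
  omega
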